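/- Let $\Omega\subset\mathbb{R}^2$ be a closed convex $n$-gon, i.e. the convex hull of $n$ points, none of which lies in the convex hull of the others, with non-empty interior, and let $A\in(0,|\Omega|)$, where $|\cdot|$ denotes area. For a convex set $\omega\subset\mathbb{R}^2$ with positive area let $\operatorname{Per}(\omega)=\mathcal{H}^1(\partial\omega)$ be the length of its boundary. Then the problem $$\max\{\operatorname{Per}(\omega) : \omega\subset\Omega \text{ convex},\ |\omega|=A\}$$ has a solution which is a convex polygon $P$ with at most $2n$ sides that is inscribed in $\Omega$, i.e. all vertices of $P$ lie on $\partial\Omega$. -/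

import Mathlib

open MeasureTheory Measure

/-- The Euclidean plane. -/
abbrev Plane : Type := EuclideanSpace ℝ (Fin 2)

/-- `P` is a (closed, non-degenerate) convex polygon whose vertices are exactly the points of the
finite set `V`: no point of `V` is redundant, i.e. none lies in the convex hull of the others.
Its number of sides is the number `V.card` of its vertices (automatically at least `3`). -/
structure IsConvexPolygon (V : Finset Plane) (P : Set Plane) : Prop where
  eq_convexHull : P = convexHull ℝ (V : Set Plane)
  convexIndependent : ConvexIndependent ℝ (fun v : V => (v : Plane))
  interior_nonempty : (interior P).Nonempty

/-- The perimeter of a planar convex set with non-empty interior: the length (one-dimensional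
Hausdorff measure) of its boundary. -/
noncomputable def perimeter (ω : Set Plane) : ENNReal := μH[1] (frontier ω)

/-- The convex subsets of the container `Ω` with area `A`. -/
def admissible (Ω : Set Plane) (A : ℝ) : Set (Set Plane) :=
  {ω | Convex ℝ ω ∧ ω ⊆ Ω ∧ volume ω = ENNReal.ofReal A}

/-- `P` solves the problem of maximising the perimeter among the convex subsets of `Ω` with
area `A`. -/
def IsPerimeterMaximizer (Ω : Set Plane) (A : ℝ) (P : Set Plane) : Prop :=
  P ∈ admissible Ω A ∧ ∀ ω ∈ admissible Ω A, perimeter ω ≤ perimeter P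

/-! Slide a vertex v of a polygon parallel to the line through its neighbours a and b. The area does
not change, and among the sides only the two at v do; their total length |v - a| + |v - b| is
strictly convex in the slide. A small slide in one of the two directions therefore lengthens the
perimeter. Hence a polygon that is optimal among those with no more vertices has all its vertices on
the boundary of Ω (`ConvexIndependent.mem_frontier_of_perimeter_max`). Strict convexity of an
inscribed polygon allows at most two of its vertices on each side of Ω, so it has at most 2n
(`ConvexIndependent.card_le_two_mul`).

For a fixed bound N on the number of vertices an optimum exists by compactness of Ω^N
(`exists_perimeter_max_card_le`). The continuity this needs follows for perimeter and area alike
from monotonicity and homogeneity (`continuousAt_of_mono_of_homogeneous`); the perimeter is monotone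
because pushing boundary points along outer normals increases distances (`perimeter_mono`).

For every N ≥ n the optimum has at most 2n vertices, so the optimum for N = 2n beats every polygon
of the same area in Ω. Approximation by polygons of exactly the given area extends this to all
convex competitors (`Convex.perimeter_le_of_forall_polygon`). -/

/-! ### Monotonicity, homogeneity and finiteness of the perimeter -/

theorem Convex.exists_outer_normal_of_mem_frontier {K : Set Plane} (hK : Convex ℝ K)
    (hKi : (interior K).Nonempty) {x : Plane} (hx : x ∈ frontier K) :
    ∃ u : Plane, u ≠ 0 ∧ ∀ y ∈ K, inner ℝ u (y - x) ≤ 0 := by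
  obtain ⟨f, hf⟩ := geometric_hahn_banach_open_point hK.interior isOpen_interior hx.2
  have hle : ∀ y ∈ K, f y ≤ f x := by
    have h1 : interior K ⊆ {y | f y ≤ f x} := fun y hy => (hf y hy).le
    have h2 : closure (interior K) ⊆ {y | f y ≤ f x} :=
      closure_minimal h1 (isClosed_le f.continuous continuous_const)
    rw [hK.closure_interior_eq_closure_of_nonempty_interior hKi] at h2
    exact fun y hy => h2 (subset_closure hy)
  have hfi : ∀ y, inner ℝ ((InnerProductSpace.toDual ℝ Plane).symm f) y = f y := fun y => by
    rw [InnerProductSpace.toDual_symm_apply]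
  refine ⟨(InnerProductSpace.toDual ℝ Plane).symm f, ?_, fun y hy => ?_⟩
  · intro h
    obtain ⟨z, hz⟩ := hKi
    have := hf z hz
    rw [← hfi, ← hfi, h] at this
    simp at this
  · rw [hfi, map_sub]
    linarith [hle y hy]

theorem Bornology.IsBounded.exists_add_smul_mem_frontier {L : Set Plane}
    (hL : Bornology.IsBounded L) {x u : Plane} (hx : x ∈ L) (hu : u ≠ 0) :
    ∃ s : ℝ, 0 ≤ s ∧ x + s • u ∈ frontier L := by
  obtain ⟨R, hR⟩ := hL.subset_closedBall x
  have hu' : 0 < ‖u‖ := norm_pos_iff.2 hu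
  obtain ⟨M, hM0, hM⟩ : ∃ M : ℝ, 0 ≤ M ∧ x + M • u ∉ L := by
    refine ⟨(|R| + 1) / ‖u‖, by positivity, fun h => ?_⟩
    have := hR h
    rw [Metric.mem_closedBall, dist_eq_norm, add_sub_cancel_left, norm_smul, Real.norm_eq_abs,
      abs_of_nonneg (by positivity), div_mul_cancel₀ _ hu'.ne'] at this
    linarith [le_abs_self R]
  have hpre : IsPreconnected ((fun s : ℝ => x + s • u) '' Set.Icc 0 M) :=
    isPreconnected_Icc.image _ (by fun_prop)
  obtain ⟨y, ⟨s, hs, rfl⟩, hy⟩ : (((fun s : ℝ => x + s • u) '' Set.Icc 0 M) ∩ frontier L).Nonempty := by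
    rw [← Set.not_disjoint_iff_nonempty_inter]
    intro hdis
    have h1 := hpre.subset_or_subset isOpen_interior (isClosed_closure (s := L)).isOpen_compl
      (Set.disjoint_compl_right_iff_subset.2 interior_subset_closure) (by
        intro z hz
        by_contra hcon
        rw [Set.mem_union, not_or, Set.notMem_compl_iff] at hcon
        exact Set.disjoint_left.1 hdis hz ⟨hcon.2, hcon.1⟩)
    rcases h1 with h | h
    · exact hM (interior_subset (h ⟨M, ⟨hM0, le_rfl⟩, rfl⟩))
    · exact h ⟨0, ⟨le_rfl, hM0⟩, rfl⟩ (by simpa using subset_closure hx)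
  exact ⟨s, hs.1, hy⟩

/-- Outward displacements at two points of a convex set spread them apart: the mixed term in the
expanded square is nonnegative. -/
theorem dist_le_dist_add_of_inner_nonpos {x y u w : Plane} (hu : inner ℝ u (y - x) ≤ 0)
    (hw : inner ℝ w (x - y) ≤ 0) : dist x y ≤ dist (x + u) (y + w) := by
  rw [dist_eq_norm, dist_eq_norm]
  refine le_of_sq_le_sq ?_ (norm_nonneg _)
  have h1 : x + u - (y + w) = (x - y) + (u - w) := by abel
  have h2 : inner ℝ (x - y) (u - w) = - inner ℝ u (y - x) - inner ℝ w (x - y) := by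
    rw [inner_sub_right, real_inner_comm u, real_inner_comm w, ← neg_sub y x, inner_neg_right,
      real_inner_comm]
  rw [h1, norm_add_sq_real, h2]
  nlinarith [sq_nonneg ‖u - w‖]

/-- The perimeter is monotone on convex sets. -/
theorem perimeter_mono {K L : Set Plane} (hK : Convex ℝ K) (hKc : IsClosed K)
    (hKi : (interior K).Nonempty) (hL : Bornology.IsBounded L) (hKL : K ⊆ L) :
    perimeter K ≤ perimeter L := by
  have hex : ∀ x : frontier K, ∃ u : Plane, (∀ y ∈ K, inner ℝ u (y - x) ≤ 0) ∧
      (x : Plane) + u ∈ frontier L := by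
    rintro ⟨x, hx⟩
    obtain ⟨u, hu0, hu⟩ := hK.exists_outer_normal_of_mem_frontier hKi hx
    obtain ⟨s, hs, hs'⟩ := hL.exists_add_smul_mem_frontier (hKL (hKc.frontier_subset hx)) hu0
    refine ⟨s • u, fun y hy => ?_, hs'⟩
    rw [real_inner_smul_left]
    exact mul_nonpos_of_nonneg_of_nonpos hs (hu y hy)
  choose u hu hu' using hex
  -- The outward push is expanding, so its image, which lies in the frontier of `L`, is at least as
  -- long as the frontier of `K`. No regularity of the choice of normals is needed.
  have hanti : AntilipschitzWith 1 (fun x : frontier K => (x : Plane) + u x) := by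
    refine AntilipschitzWith.of_le_mul_dist fun x y => ?_
    rw [NNReal.coe_one, one_mul]
    exact dist_le_dist_add_of_inner_nonpos (hu x y (hKc.frontier_subset y.2))
      (hu y x (hKc.frontier_subset x.2))
  have h1 := hanti.le_hausdorffMeasure_image zero_le_one Set.univ
  have h2 := (isometry_subtype_coe (s := frontier K)).hausdorffMeasure_image
    (Or.inl zero_le_one) Set.univ
  rw [Set.image_univ, Subtype.range_coe] at h2
  rw [ENNReal.coe_one, ENNReal.one_rpow, one_mul, ← h2] at h1
  exact h1.trans (measure_mono (by rintro _ ⟨x, -, rfl⟩; exact hu' x))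

theorem isHomeomorph_homothety (c : Plane) {r : ℝ} (hr : r ≠ 0) :
    IsHomeomorph (AffineMap.homothety c r) where
  continuous := AffineMap.homothety_continuous c r
  isOpenMap := AffineMap.homothety_isOpenMap c r hr
  bijective := (AffineEquiv.homothetyUnitsMulHom c (Units.mk0 r hr)).bijective

theorem perimeter_homothety (c : Plane) {r : ℝ} (hr : 0 < r) (K : Set Plane) :
    perimeter (AffineMap.homothety c r '' K) = ENNReal.ofReal r * perimeter K := by
  have h : AffineMap.homothety c r '' frontier K = frontier (AffineMap.homothety c r '' K) :=
    (isHomeomorph_homothety c hr.ne').homeomorph.image_frontier K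
  rw [perimeter, ← h, hausdorffMeasure_homothety_image zero_le_one c hr.ne', NNReal.rpow_one,
    ENNReal.smul_def, smul_eq_mul, perimeter]
  congr 1
  rw [← Real.enorm_of_nonneg hr.le]
  rfl

theorem frontier_convexHull_affineBasis {ι : Type*} [Finite ι] (B : AffineBasis ι ℝ Plane) :
    frontier (convexHull ℝ (Set.range B)) = {x | (∀ i, 0 ≤ B.coord i x) ∧ ∃ i, B.coord i x = 0} := by
  rw [((Set.finite_range B).isClosed_convexHull ℝ).frontier_eq, B.interior_convexHull,
    B.convexHull_eq_nonneg_coord]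
  ext x
  simp only [Set.mem_sdiff, Set.mem_ofPred_eq, not_forall, not_lt]
  exact and_congr_right fun h => exists_congr fun i => ⟨fun h' => le_antisymm h' (h i), fun h' => h'.le⟩

theorem AffineBasis.mem_segment_of_coord_eq_zero (B : AffineBasis (Fin 3) ℝ Plane)
    {i j k : Fin 3} (hij : i ≠ j) (hik : i ≠ k) (hjk : j ≠ k) {x : Plane}
    (hx : ∀ i, 0 ≤ B.coord i x) (h0 : B.coord i x = 0) : x ∈ segment ℝ (B j) (B k) := by
  have huniv : (Finset.univ : Finset (Fin 3)) = {i, j, k} := by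
    clear h0; revert i j k; decide
  have h1 := B.sum_coord_apply_eq_one x
  have h2 := B.linear_combination_coord_eq_self x
  rw [huniv, Finset.sum_insert (by simp [hij, hik]), Finset.sum_pair hjk, h0] at h1 h2
  refine ⟨B.coord j x, B.coord k x, hx j, hx k, by linarith, ?_⟩
  rwa [zero_smul, zero_add] at h2

theorem perimeter_convexHull_affineBasis_lt_top (B : AffineBasis (Fin 3) ℝ Plane) :
    perimeter (convexHull ℝ (Set.range B)) < ⊤ := by
  have hsub : frontier (convexHull ℝ (Set.range B)) ⊆
      segment ℝ (B 1) (B 2) ∪ segment ℝ (B 0) (B 2) ∪ segment ℝ (B 0) (B 1) := by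
    rw [frontier_convexHull_affineBasis]
    rintro x ⟨hx, i, hi⟩
    fin_cases i
    · exact Or.inl (Or.inl (B.mem_segment_of_coord_eq_zero (by decide) (by decide) (by decide) hx hi))
    · exact Or.inl (Or.inr (B.mem_segment_of_coord_eq_zero (by decide) (by decide) (by decide) hx hi))
    · exact Or.inr (B.mem_segment_of_coord_eq_zero (by decide) (by decide) (by decide) hx hi)
  refine (measure_mono hsub).trans_lt ?_
  refine measure_union_lt_top (measure_union_lt_top ?_ ?_) ?_ <;>
  · rw [hausdorffMeasure_segment]
    exact edist_lt_top _ _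

theorem Bornology.IsBounded.subset_homothety_image {K L : Set Plane} (hL : Bornology.IsBounded L)
    {c : Plane} (hc : c ∈ interior K) : ∃ r : ℝ, 0 < r ∧ L ⊆ AffineMap.homothety c r '' K := by
  obtain ⟨δ, hδ, hδK⟩ := Metric.isOpen_iff.1 isOpen_interior c hc
  obtain ⟨R, hR⟩ := hL.subset_closedBall c
  have hr : 0 < (|R| + 1) / δ := by positivity
  refine ⟨(|R| + 1) / δ, hr, fun x hx => ?_⟩
  refine ⟨AffineMap.homothety c ((|R| + 1) / δ)⁻¹ x, interior_subset (hδK ?_),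
    (AffineEquiv.homothetyUnitsMulHom c (Units.mk0 _ hr.ne')).apply_symm_apply x⟩
  rw [Metric.mem_ball, dist_homothety_center, Real.norm_eq_abs, abs_of_pos (inv_pos.2 hr), inv_div,
    div_mul_eq_mul_div, div_lt_iff₀ (by positivity)]
  have h1 := Metric.mem_closedBall.1 (hR hx)
  rw [dist_comm] at h1
  exact mul_lt_mul_of_pos_left (by linarith [le_abs_self R]) hδ

/-- A triangle has finite perimeter, and a scaled copy of it contains `K`; monotonicity does the
rest. -/
theorem perimeter_lt_top {K : Set Plane} (hK : Convex ℝ K) (hKc : IsCompact K)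
    (hKi : (interior K).Nonempty) : perimeter K < ⊤ := by
  obtain ⟨B⟩ := AffineBasis.exists_affineBasis_of_finiteDimensional (ι := Fin 3) (k := ℝ) (P := Plane) (by simp)
  obtain ⟨c, hc⟩ : (interior (convexHull ℝ (Set.range B))).Nonempty :=
    ⟨_, B.centroid_mem_interior_convexHull⟩
  obtain ⟨r, hr, hsub⟩ := hKc.isBounded.subset_homothety_image hc
  refine (perimeter_mono hK hKc.isClosed hKi ?_ hsub).trans_lt ?_
  · exact (((Set.finite_range B).isCompact_convexHull ℝ).image
      (AffineMap.homothety_continuous c r)).isBounded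
  · rw [perimeter_homothety c hr]
    exact ENNReal.mul_lt_top ENNReal.ofReal_lt_top (perimeter_convexHull_affineBasis_lt_top B)

/-! ### Continuity of perimeter and area in the vertices -/

open Filter Topology in
theorem eventually_convexHull_range_subset {ι : Type*} [Finite ι] {p₀ : ι → Plane} {L : Set Plane}
    (hL : Convex ℝ L) (h : ∀ i, p₀ i ∈ interior L) :
    ∀ᶠ p in 𝓝 p₀, convexHull ℝ (Set.range p) ⊆ L := by
  have : ∀ᶠ p in 𝓝 p₀, ∀ i, p i ∈ L := eventually_all.2 fun i =>
    (continuous_apply i).continuousAt.eventually (mem_interior_iff_mem_nhds.1 (h i))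
  filter_upwards [this] with p hp
  exact convexHull_min (Set.range_subset_iff.2 hp) hL

-- A support function argument: moving the vertices by less than (1 - r)ρ/2 lowers the support
-- function in direction u by at most (1 - r)ρ/2 · ‖u‖. Shrinking by r towards the centre of a ball
-- of radius ρ in the hull gains at least this much.
open Filter Topology in
theorem eventually_subset_convexHull_range {ι : Type*} [Finite ι] {p₀ : ι → Plane} {c : Plane}
    (hc : c ∈ interior (convexHull ℝ (Set.range p₀))) {r : ℝ} (hr : 0 < r) (hr1 : r < 1) :
    ∀ᶠ p in 𝓝 p₀, AffineMap.homothety c r '' convexHull ℝ (Set.range p₀) ⊆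
      convexHull ℝ (Set.range p) := by
  obtain ⟨ρ, hρ, hρK⟩ := Metric.isOpen_iff.1 isOpen_interior c hc
  have hδ : 0 < (1 - r) * ρ / 2 := by nlinarith
  have hev : ∀ᶠ p in 𝓝 p₀, ∀ i, p i ∈ Metric.ball (p₀ i) ((1 - r) * ρ / 2) := eventually_all.2
    fun i => (continuous_apply i).continuousAt.eventually (Metric.ball_mem_nhds _ hδ)
  filter_upwards [hev] with p hp
  rintro _ ⟨x, hx, rfl⟩
  by_contra hnot
  obtain ⟨f, s, hfs, hs⟩ := geometric_hahn_banach_closed_point (convex_convexHull ℝ (Set.range p))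
    ((Set.finite_range p).isClosed_convexHull ℝ) hnot
  set u : Plane := (InnerProductSpace.toDual ℝ Plane).symm f with hu
  have hfi : ∀ y, f y = inner ℝ u y := fun y => by
    rw [hu, InnerProductSpace.toDual_symm_apply]
  have hu0 : 0 < ‖u‖ := by
    obtain ⟨i⟩ : Nonempty ι := by
      by_contra hne
      rw [not_nonempty_iff] at hne
      rw [Set.range_eq_empty, convexHull_empty] at hx
      exact hx
    rw [norm_pos_iff]
    intro h0
    have := hfs _ (subset_convexHull ℝ _ ⟨i, rfl⟩)
    rw [hfi, h0, inner_zero_left] at this hs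
    linarith
  have hbound : ∀ y ∈ convexHull ℝ (Set.range p₀), inner ℝ u y ≤ s + (1 - r) * ρ / 2 * ‖u‖ := by
    intro y hy
    have hsub : convexHull ℝ (Set.range p₀) ⊆ {y | f y ≤ s + (1 - r) * ρ / 2 * ‖u‖} := by
      refine convexHull_min ?_ (convex_halfSpace_le f.toLinearMap.isLinear _)
      rintro _ ⟨i, rfl⟩
      have h1 := hfs _ (subset_convexHull ℝ _ ⟨i, rfl⟩)
      have h2 := hp i
      rw [Metric.mem_ball, dist_comm, dist_eq_norm] at h2
      have h3 := real_inner_le_norm u (p₀ i - p i)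
      have h4 : f (p₀ i) = f (p i) + inner ℝ u (p₀ i - p i) := by
        rw [← hfi, map_sub]; ring
      change f (p₀ i) ≤ _
      nlinarith
    rw [← hfi]
    exact hsub hy
  have hz : c + (ρ / 2 / ‖u‖) • u ∈ convexHull ℝ (Set.range p₀) := by
    refine interior_subset (hρK ?_)
    rw [Metric.mem_ball, dist_eq_norm, add_sub_cancel_left, norm_smul, Real.norm_eq_abs,
      abs_of_pos (by positivity), div_mul_cancel₀ _ hu0.ne']
    linarith
  have h1 := hbound _ hz
  have h2 := hbound _ hx
  rw [inner_add_right, inner_smul_right, real_inner_self_eq_norm_sq] at h1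
  have h3 : ρ / 2 / ‖u‖ * ‖u‖ ^ 2 = ρ / 2 * ‖u‖ := by field_simp
  rw [h3] at h1
  rw [AffineMap.homothety_apply, hfi, vsub_eq_sub, vadd_eq_add, inner_add_right, inner_smul_right,
    inner_sub_right] at hs
  nlinarith

open Filter Topology in
/-- A monotone and homogeneous functional on planar convex bodies is continuous along convex hulls
of finite families of points, away from degenerate hulls. -/
theorem continuousAt_of_mono_of_homogeneous {ι : Type*} [Finite ι] (F : Set Plane → ENNReal) (k : ℕ)
    (hmono : ∀ K L : Set Plane, Convex ℝ K → IsCompact K → (interior K).Nonempty → IsCompact L →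
      K ⊆ L → F K ≤ F L)
    (hhom : ∀ (c : Plane) (r : ℝ) (K : Set Plane), 0 < r →
      F (AffineMap.homothety c r '' K) = ENNReal.ofReal r ^ k * F K)
    {p₀ : ι → Plane} (hint : (interior (convexHull ℝ (Set.range p₀))).Nonempty)
    (hfin : F (convexHull ℝ (Set.range p₀)) ≠ ⊤) :
    ContinuousAt (fun p : ι → Plane => F (convexHull ℝ (Set.range p))) p₀ := by
  obtain ⟨c, hc⟩ := hint
  set K := convexHull ℝ (Set.range p₀)
  have hK : Convex ℝ K := convex_convexHull ℝ _
  have hKc : IsCompact K := (Set.finite_range p₀).isCompact_convexHull ℝ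
  have hconv : ∀ r : ℝ, Convex ℝ (AffineMap.homothety c r '' K) := fun r =>
    hK.affine_image (AffineMap.homothety c r)
  have hcomp : ∀ r : ℝ, IsCompact (AffineMap.homothety c r '' K) := fun r =>
    hKc.image (AffineMap.homothety_continuous c r)
  have hcint : ∀ r : ℝ, r ≠ 0 → c ∈ interior (AffineMap.homothety c r '' K) := fun r hr =>
    (AffineMap.homothety_isOpenMap c r hr).image_interior_subset K
      ⟨c, hc, AffineMap.homothety_apply_same c r⟩
  have hφ : Continuous fun r : ℝ => ENNReal.ofReal r ^ k * F K :=
    (ENNReal.continuous_mul_const hfin).comp ((ENNReal.continuous_pow k).comp ENNReal.continuous_ofReal)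
  have hφ1 : ENNReal.ofReal 1 ^ k * F K = F K := by simp
  -- The shrunken copy of `K` bounds nearby hulls from below and also keeps them non-degenerate.
  have hlow : ∀ r : ℝ, 0 < r → r < 1 → ∀ᶠ p in 𝓝 p₀, (interior (convexHull ℝ (Set.range p))).Nonempty ∧
      ENNReal.ofReal r ^ k * F K ≤ F (convexHull ℝ (Set.range p)) := by
    intro r hr hr1
    filter_upwards [eventually_subset_convexHull_range hc hr hr1] with p hp
    refine ⟨⟨c, interior_mono hp (hcint r hr.ne')⟩, ?_⟩
    rw [← hhom c r K hr]
    exact hmono _ _ (hconv r) (hcomp r) ⟨c, hcint r hr.ne'⟩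
      ((Set.finite_range p).isCompact_convexHull ℝ) hp
  refine tendsto_order.2 ⟨fun a ha => ?_, fun a ha => ?_⟩
  · have h1 : ∀ᶠ r : ℝ in 𝓝[<] 1, a < ENNReal.ofReal r ^ k * F K := by
      refine (hφ.continuousAt.eventually (lt_mem_nhds ?_)).filter_mono nhdsWithin_le_nhds
      change a < ENNReal.ofReal 1 ^ k * F K
      rwa [hφ1]
    obtain ⟨r, hr, hr0, hr1⟩ := (h1.and (Ioo_mem_nhdsLT (zero_lt_one' ℝ))).exists
    filter_upwards [hlow r hr0 hr1] with p hp
    exact hr.trans_le hp.2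
  · have h1 : ∀ᶠ r : ℝ in 𝓝[>] 1, ENNReal.ofReal r ^ k * F K < a := by
      refine (hφ.continuousAt.eventually (gt_mem_nhds ?_)).filter_mono nhdsWithin_le_nhds
      change ENNReal.ofReal 1 ^ k * F K < a
      rwa [hφ1]
    obtain ⟨r, hr, hr1⟩ := (h1.and self_mem_nhdsWithin).exists
    replace hr1 : 1 < r := hr1
    have hr0 : 0 < r := by linarith
    -- The ratio 1/2 is arbitrary: it only supplies the non-empty interior that `hmono` requires of
    -- the smaller body.
    filter_upwards [eventually_convexHull_range_subset (hconv r) fun i =>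
      hK.subset_interior_image_homothety_of_one_lt hc r hr1 (subset_convexHull ℝ _ ⟨i, rfl⟩),
      hlow (1 / 2) (by norm_num) (by norm_num)] with p hp hp'
    refine lt_of_le_of_lt ?_ hr
    rw [← hhom c r K hr0]
    exact hmono _ _ (convex_convexHull ℝ _) ((Set.finite_range p).isCompact_convexHull ℝ) hp'.1
      (hcomp r) hp

theorem continuousAt_perimeter_convexHull_range {ι : Type*} [Finite ι] {p₀ : ι → Plane}
    (hint : (interior (convexHull ℝ (Set.range p₀))).Nonempty) :
    ContinuousAt (fun p : ι → Plane => perimeter (convexHull ℝ (Set.range p))) p₀ :=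
  continuousAt_of_mono_of_homogeneous perimeter 1
    (fun _ _ hK hKc hKi hL hKL => perimeter_mono hK hKc.isClosed hKi hL.isBounded hKL)
    (fun c r K hr => by rw [perimeter_homothety c hr, pow_one]) hint
    (perimeter_lt_top (convex_convexHull ℝ _) ((Set.finite_range p₀).isCompact_convexHull ℝ) hint).ne

theorem continuousAt_volume_convexHull_range {ι : Type*} [Finite ι] {p₀ : ι → Plane}
    (hint : (interior (convexHull ℝ (Set.range p₀))).Nonempty) :
    ContinuousAt (fun p : ι → Plane => volume (convexHull ℝ (Set.range p))) p₀ :=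
  continuousAt_of_mono_of_homogeneous volume 2
    (fun _ _ _ _ _ _ hKL => measure_mono hKL)
    (fun c r K hr => by
      rw [addHaar_image_homothety, finrank_euclideanSpace_fin, abs_of_nonneg (by positivity),
        ENNReal.ofReal_pow hr.le]) hint
    ((Set.finite_range p₀).isCompact_convexHull ℝ).measure_ne_top

/-! ### Existence of optimal polygons with boundedly many vertices -/

theorem Convex.interior_nonempty_of_volume_ne_zero {K : Set Plane} (hK : Convex ℝ K)
    (h : volume K ≠ 0) : (interior K).Nonempty := by
  by_contra hne
  rw [Set.not_nonempty_iff_eq_empty] at hne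
  refine h (measure_mono_null (fun x hx => ?_) (hK.addHaar_frontier volume))
  rw [frontier, hne, Set.sdiff_empty]
  exact subset_closure hx

-- Continuity of the area is available only at non-degenerate hulls. Closed thickenings of the limit
-- hull contain nearby hulls, so the limit has area at least `a`; as `a` is nonzero, it is
-- non-degenerate and continuity applies.
open Filter Topology in
theorem isClosed_setOf_volume_convexHull_range_eq {ι : Type*} [Finite ι] {a : ENNReal} (ha : a ≠ 0) :
    IsClosed {p : ι → Plane | volume (convexHull ℝ (Set.range p)) = a} := by
  refine isClosed_of_closure_subset fun p₀ hp₀ => ?_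
  set C := {p : ι → Plane | volume (convexHull ℝ (Set.range p)) = a}
  have hne : (𝓝[C] p₀).NeBot := mem_closure_iff_nhdsWithin_neBot.1 hp₀
  have hKc : IsCompact (convexHull ℝ (Set.range p₀)) := (Set.finite_range p₀).isCompact_convexHull ℝ
  have hle : a ≤ volume (convexHull ℝ (Set.range p₀)) := by
    have hlim := (tendsto_measure_cthickening_of_isCompact (μ := volume) hKc).mono_left
      (nhdsWithin_le_nhds (s := Set.Ioi 0))
    refine ge_of_tendsto hlim ?_
    filter_upwards [self_mem_nhdsWithin] with δ hδ
    have h1 := eventually_convexHull_range_subset (p₀ := p₀)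
      ((convex_convexHull ℝ (Set.range p₀)).cthickening δ) (fun i =>
        interior_maximal (Metric.thickening_subset_cthickening δ _) Metric.isOpen_thickening
          (Metric.self_subset_thickening hδ _ (subset_convexHull ℝ _ ⟨i, rfl⟩)))
    obtain ⟨p, hp, hpC⟩ := ((h1.filter_mono nhdsWithin_le_nhds).and
      (self_mem_nhdsWithin : C ∈ 𝓝[C] p₀)).exists
    rw [← show volume (convexHull ℝ (Set.range p)) = a from hpC]
    exact measure_mono hp
  have hint := (convex_convexHull ℝ (Set.range p₀)).interior_nonempty_of_volume_ne_zero
    (pos_of_ne_zero ha |>.trans_le hle).ne'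
  have h1 := (continuousAt_volume_convexHull_range hint).tendsto.mono_left
    (nhdsWithin_le_nhds (s := C))
  refine tendsto_nhds_unique h1 (tendsto_const_nhds.congr' ?_)
  filter_upwards [self_mem_nhdsWithin] with p hp
  exact hp.symm

theorem Finset.exists_range_eq_of_card_le {S : Finset Plane} (hS : S.Nonempty) {N : ℕ}
    (hN : S.card ≤ N) : ∃ p : Fin N → Plane, Set.range p = S := by
  have : Nonempty S := hS.coe_sort
  obtain ⟨e⟩ := Function.Embedding.nonempty_of_card_le (α := S) (β := Fin N) (by simpa using hN)
  refine ⟨fun i => (Function.invFun e i : S), ?_⟩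
  ext x
  refine ⟨?_, fun hx => ⟨e ⟨x, hx⟩, congrArg Subtype.val (Function.leftInverse_invFun e.injective ⟨x, hx⟩)⟩⟩
  rintro ⟨i, rfl⟩
  exact (Function.invFun e i).2

/-- Among the polygons of given area with at most `N` vertices in a compact set there is one of
maximal perimeter. -/
theorem exists_perimeter_max_card_le {Ω : Set Plane} (hΩ : IsCompact Ω) {a : ENNReal} (ha : a ≠ 0)
    (N : ℕ) (hex : ∃ S : Finset Plane, (S : Set Plane) ⊆ Ω ∧ S.card ≤ N ∧
      volume (convexHull ℝ (S : Set Plane)) = a) :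
    ∃ S : Finset Plane, (S : Set Plane) ⊆ Ω ∧ S.card ≤ N ∧ volume (convexHull ℝ (S : Set Plane)) = a ∧
      ∀ S' : Finset Plane, (S' : Set Plane) ⊆ Ω → S'.card ≤ N →
        volume (convexHull ℝ (S' : Set Plane)) = a →
        perimeter (convexHull ℝ (S' : Set Plane)) ≤ perimeter (convexHull ℝ (S : Set Plane)) := by
  set C := (Set.univ.pi fun _ : Fin N => Ω) ∩
    {p : Fin N → Plane | volume (convexHull ℝ (Set.range p)) = a} with hC
  have hCc : IsCompact C := (isCompact_univ_pi fun _ => hΩ).inter_right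
    (isClosed_setOf_volume_convexHull_range_eq ha)
  have hcont : ContinuousOn (fun p : Fin N → Plane => perimeter (convexHull ℝ (Set.range p))) C := by
    intro p hp
    refine (continuousAt_perimeter_convexHull_range
      ((convex_convexHull ℝ _).interior_nonempty_of_volume_ne_zero ?_)).continuousWithinAt
    rw [show volume (convexHull ℝ (Set.range p)) = a from hp.2]
    exact ha
  have hfinset : ∀ S : Finset Plane, (S : Set Plane) ⊆ Ω → S.card ≤ N →
      volume (convexHull ℝ (S : Set Plane)) = a → ∃ p ∈ C, Set.range p = S := by
    intro S hS hSN hSa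
    have hne : S.Nonempty := by
      by_contra h
      rw [Finset.not_nonempty_iff_eq_empty] at h
      rw [h] at hSa
      simp at hSa
      exact ha hSa.symm
    obtain ⟨p, hp⟩ := Finset.exists_range_eq_of_card_le hne hSN
    refine ⟨p, ⟨fun i _ => hS (hp ▸ ⟨i, rfl⟩), ?_⟩, hp⟩
    change volume (convexHull ℝ (Set.range p)) = a
    rw [hp, hSa]
  obtain ⟨S₀, hS₀, hS₀N, hS₀a⟩ := hex
  obtain ⟨p₀, hp₀, -⟩ := hfinset S₀ hS₀ hS₀N hS₀a
  obtain ⟨p, hp, hmax⟩ := hCc.exists_isMaxOn ⟨p₀, hp₀⟩ hcont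
  have hrange : ((Finset.univ.image p : Finset Plane) : Set Plane) = Set.range p := by simp
  refine ⟨Finset.univ.image p, ?_, ?_, ?_, fun S' hS' hS'N hS'a => ?_⟩
  · rw [hrange]
    exact Set.range_subset_iff.2 fun i => hp.1 i trivial
  · exact Finset.card_image_le.trans (by simp)
  · rw [hrange]
    exact hp.2
  · obtain ⟨q, hq, hqS⟩ := hfinset S' hS' hS'N hS'a
    rw [hrange, ← hqS]
    exact hmax hq

/-! ### Counting the vertices of an inscribed polygon -/

/-- The signed area of the parallelogram spanned by two vectors of the plane. -/
def cross (x y : Plane) : ℝ := x 0 * y 1 - x 1 * y 0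

theorem Plane.inner_eq (x y : Plane) : inner ℝ x y = x 0 * y 0 + x 1 * y 1 := by
  simp [PiLp.inner_apply, Fin.sum_univ_two, mul_comm]

theorem cross_sub_right (x y z : Plane) : cross x (y - z) = cross x y - cross x z := by
  simp [cross]; ring

theorem cross_smul_right (x y : Plane) (r : ℝ) : cross x (r • y) = r * cross x y := by
  simp [cross]; ring

theorem cross_swap (x y : Plane) : cross x y = -cross y x := by
  simp [cross]; ring

/-- Cramer's rule, which yields coordinates in the frame of two neighbours of a vertex. -/
theorem cross_smul_eq (x y z : Plane) : cross x y • z = cross z y • x + cross x z • y := by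
  ext i
  fin_cases i <;> simp [cross] <;> ring

/-- The determinant of x and y evaluated in the orthogonal frame formed by u and its rotation by a
right angle. -/
theorem inner_self_mul_cross (u x y : Plane) :
    inner ℝ u u * cross x y = inner ℝ u x * cross u y - cross u x * inner ℝ u y := by
  simp only [Plane.inner_eq, cross]; ring

theorem eq_smul_of_cross_eq_zero {x y : Plane} (hx : x ≠ 0) (h : cross x y = 0) :
    y = (inner ℝ x y / inner ℝ x x) • x := by
  have hxx : inner ℝ x x ≠ 0 := inner_self_ne_zero.2 hx
  rw [Plane.inner_eq] at hxx
  simp only [cross] at h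
  ext i
  rw [PiLp.smul_apply, smul_eq_mul, div_mul_eq_mul_div, eq_div_iff (by rwa [Plane.inner_eq]),
    Plane.inner_eq, Plane.inner_eq]
  fin_cases i
  · simp only [Fin.zero_eta]
    linear_combination (-x 1) * h
  · simp only [Fin.mk_one]
    linear_combination (x 0) * h

/-- Write `w` as a convex combination of `V`. Since `w` maximises `f`, every point with positive
weight lies on the face `f = f w`, and on these points `g` averages to `g w`. -/
theorem exists_mem_face_le {V : Finset Plane} {w : Plane} (hw : w ∈ convexHull ℝ (V : Set Plane))
    (f g : Plane →ₗ[ℝ] ℝ) (hf : ∀ v ∈ V, f v ≤ f w) : ∃ v ∈ V, f v = f w ∧ g v ≤ g w := by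
  obtain ⟨l, hl0, hl1, hlw⟩ := Finset.mem_convexHull'.1 hw
  have hsum : ∀ h : Plane →ₗ[ℝ] ℝ, ∑ v ∈ V, l v * (h v - h w) = 0 := fun h => by
    simp_rw [mul_sub]
    rw [Finset.sum_sub_distrib, ← Finset.sum_mul, hl1, one_mul, sub_eq_zero]
    conv_rhs => rw [← hlw, _root_.map_sum]
    simp
  have hpos : ∃ v ∈ V, 0 < l v := by
    by_contra! hcon
    linarith [Finset.sum_nonpos hcon]
  have hface : ∀ v ∈ V, 0 < l v → f v = f w := fun v hv hlv => by
    have h1 := (Finset.sum_eq_zero_iff_of_nonpos fun v hv =>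
      mul_nonpos_of_nonneg_of_nonpos (hl0 v hv) (sub_nonpos.2 (hf v hv))).1 (hsum f) v hv
    exact sub_eq_zero.1 ((mul_eq_zero.1 h1).resolve_left hlv.ne')
  by_contra! hcon
  have hg : 0 < ∑ v ∈ V, l v * (g v - g w) := by
    refine Finset.sum_pos' (fun v hv => ?_) ?_
    · rcases (hl0 v hv).eq_or_lt with h | h
      · rw [← h, zero_mul]
      · exact mul_nonneg h.le (sub_nonneg.2 (hcon v hv (hface v hv h)).le)
    · obtain ⟨v, hv, h⟩ := hpos
      exact ⟨v, hv, mul_pos h (sub_pos.2 (hcon v hv (hface v hv h)))⟩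
  exact hg.ne' (hsum g)

theorem ConvexIndependent.notMem_convexHull_of_subset {W : Finset Plane}
    (hW : ConvexIndependent ℝ (fun v : W => (v : Plane))) {x : Plane} (hx : x ∈ W) {s : Set Plane}
    (hs : s ⊆ W) (hxs : x ∉ s) : x ∉ convexHull ℝ s := fun h => by
  have hsub : s ⊆ (W : Set Plane) \ {x} := fun y hy => ⟨hs hy, fun hyx => hxs (hyx ▸ hy)⟩
  exact (convexIndependent_set_iff_notMem_convexHull_sdiff (s := (W : Set Plane))).1 hW x hx
    (convexHull_mono hsub h)

theorem ConvexIndependent.notMem_segment {W : Finset Plane}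
    (hW : ConvexIndependent ℝ (fun v : W => (v : Plane))) {x y z : Plane} (hx : x ∈ W) (hy : y ∈ W)
    (hz : z ∈ W) (hyx : y ≠ x) (hyz : y ≠ z) : y ∉ segment ℝ x z := by
  rw [← convexHull_pair]
  refine hW.notMem_convexHull_of_subset hy ?_ (by simp [hyx, hyz])
  rintro t (rfl | rfl) <;> assumption

/-- A polygon inscribed in a convex polygon with `n` vertices has at most `2 * n` vertices. -/
theorem ConvexIndependent.card_le_two_mul {V W : Finset Plane}
    (hW : ConvexIndependent ℝ (fun v : W => (v : Plane)))
    (hint : (interior (convexHull ℝ (V : Set Plane))).Nonempty)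
    (hWV : ∀ w ∈ W, w ∈ frontier (convexHull ℝ (V : Set Plane))) : W.card ≤ 2 * V.card := by
  classical
  have hcl : IsClosed (convexHull ℝ (V : Set Plane)) := V.finite_toSet.isClosed_convexHull ℝ
  -- Each `w` is assigned a vertex `v` on its supporting line, always on the same side of `w` as
  -- seen from the outer normal. This orientation makes each vertex answer for one side of the
  -- polygon only.
  have hex : ∀ w ∈ W, ∃ v ∈ V, ∃ u : Plane, u ≠ 0 ∧
      (∀ y ∈ convexHull ℝ (V : Set Plane), inner ℝ u (y - w) ≤ 0) ∧ inner ℝ u (w - v) = 0 ∧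
      0 ≤ cross u (w - v) := by
    intro w hw
    obtain ⟨u, hu0, hu⟩ := (convex_convexHull ℝ _).exists_outer_normal_of_mem_frontier hint (hWV w hw)
    let g : Plane →ₗ[ℝ] ℝ :=
      { toFun := cross u
        map_add' := fun x y => by simp [cross]; ring
        map_smul' := fun r x => by simp [cross]; ring }
    obtain ⟨v, hv, h1, h2⟩ := exists_mem_face_le (hcl.frontier_subset (hWV w hw))
      (innerₛₗ ℝ u) g (fun v hv => by
        have := hu v (subset_convexHull ℝ _ hv)
        rw [inner_sub_right] at this
        simpa using this)
    refine ⟨v, hv, u, hu0, hu, ?_, ?_⟩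
    · rw [inner_sub_right]
      simp only [innerₛₗ_apply_apply] at h1
      rw [h1, sub_self]
    · rw [cross_sub_right]
      exact sub_nonneg.2 h2
  choose! φ hφV u hu0 hu hin hcr using hex
  have hmemhull : ∀ w ∈ W, w ∈ convexHull ℝ (V : Set Plane) := fun w hw => hcl.frontier_subset (hWV w hw)
  -- The normal at `x` forces the cross product to be nonnegative, the normal at `y` forces it to be
  -- nonpositive. Thus the points assigned to one vertex are collinear, and convex independence
  -- leaves at most two.
  have hcross : ∀ x ∈ W, ∀ y ∈ W, φ x = φ y → cross (x - φ x) (y - φ x) = 0 := by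
    intro x hx y hy hxy
    have hx1 := hin x hx
    have hy1 := hin y hy
    have hx2 := hcr x hx
    have hy2 := hcr y hy
    have hx3 := hu x hx y (hmemhull y hy)
    have hy3 := hu y hy x (hmemhull x hx)
    rw [← hxy] at hy1 hy2
    have hpx : 0 < inner ℝ (u x) (u x) := real_inner_self_pos.2 (hu0 x hx)
    have hpy : 0 < inner ℝ (u y) (u y) := real_inner_self_pos.2 (hu0 y hy)
    have ex := inner_self_mul_cross (u x) (x - φ x) (y - φ x)
    have ey := inner_self_mul_cross (u y) (x - φ x) (y - φ x)
    have hx4 : inner ℝ (u x) (y - φ x) ≤ 0 := by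
      rw [← sub_add_sub_cancel y x, inner_add_right, hx1]; linarith
    have hy4 : inner ℝ (u y) (x - φ x) ≤ 0 := by
      rw [← sub_add_sub_cancel x y, inner_add_right, hy1]; linarith
    rw [hx1] at ex
    rw [hy1] at ey
    refine le_antisymm ?_ ?_
    · by_contra! h
      nlinarith [mul_pos hpy h]
    · by_contra! h
      nlinarith [mul_neg_of_pos_of_neg hpx h]
  have hfiber : ∀ v ∈ W.image φ, (W.filter fun w => φ w = v).card ≤ 2 := by
    intro v _
    by_contra! hcard
    obtain ⟨x, hx, y, hy, z, hz, hxy, hxz, hyz⟩ := Finset.two_lt_card.1 hcard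
    rw [Finset.mem_filter] at hx hy hz
    have h1 := hcross x hx.1 y hy.1 (hx.2.trans hy.2.symm)
    have h2 := hcross x hx.1 z hz.1 (hx.2.trans hz.2.symm)
    have h3 := hcross y hy.1 z hz.1 (hy.2.trans hz.2.symm)
    rw [hx.2] at h1 h2
    rw [hy.2] at h3
    have h4 : cross (y - x) (z - x) = 0 := by
      simp only [cross, PiLp.sub_apply] at h1 h2 h3 ⊢
      linear_combination h3 - h2 + h1
    have hcol : Collinear ℝ ({x, y, z} : Set Plane) := by
      rw [collinear_iff_of_mem (p₀ := x) (by simp)]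
      refine ⟨y - x, ?_⟩
      rintro p (rfl | rfl | rfl)
      · exact ⟨0, by simp⟩
      · exact ⟨1, by simp⟩
      · refine ⟨inner ℝ (y - x) (p - x) / inner ℝ (y - x) (y - x), ?_⟩
        rw [← eq_smul_of_cross_eq_zero (sub_ne_zero.2 hxy.symm) h4]
        simp
    rcases hcol.wbtw_or_wbtw_or_wbtw with h | h | h <;> rw [← mem_segment_iff_wbtw] at h
    · exact hW.notMem_segment hx.1 hy.1 hz.1 hxy.symm hyz h
    · exact hW.notMem_segment hy.1 hz.1 hx.1 hyz.symm hxz.symm h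
    · exact hW.notMem_segment hz.1 hx.1 hy.1 hxz hxy h
  calc W.card ≤ 2 * (W.image φ).card := Finset.card_le_mul_card_image W 2 hfiber
    _ ≤ 2 * V.card := by
      gcongr
      exact Finset.image_subset_iff.2 hφV

/-! ### The neighbours of a vertex -/

theorem interior_eq_empty_of_cross_eq {K : Set Plane} {d : Plane} (hd : d ≠ 0) {r : ℝ}
    (h : ∀ x ∈ K, cross d x = r) : interior K = ∅ := by
  by_contra hne
  obtain ⟨z, hz⟩ := Set.nonempty_iff_ne_empty.2 hne
  obtain ⟨δ, hδ, hball⟩ := Metric.isOpen_iff.1 isOpen_interior z hz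
  have hdd : 0 < inner ℝ d d := real_inner_self_pos.2 hd
  let e : Plane := !₂[-d 1, d 0]
  have hcr : cross d e = inner ℝ d d := by
    rw [Plane.inner_eq]
    simp [cross, e]
  have he : e ≠ 0 := fun h0 => by
    rw [← hcr, h0] at hdd
    simp [cross] at hdd
  have he0 : 0 < ‖e‖ := norm_pos_iff.2 he
  have hmem : z - (δ / 2 / ‖e‖) • e ∈ K := by
    refine interior_subset (hball ?_)
    rw [Metric.mem_ball, dist_eq_norm, sub_sub_cancel_left, norm_neg, norm_smul, Real.norm_eq_abs,
      abs_of_pos (by positivity), div_mul_cancel₀ _ he0.ne']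
    linarith
  have h1 := h _ hmem
  rw [cross_sub_right, h z (interior_subset hz), cross_smul_right, hcr] at h1
  have : 0 < δ / 2 / ‖e‖ * inner ℝ d d := by positivity
  linarith

/-- The two neighbours `a`, `b` of a vertex `v` of a convex polygon: in the affine frame `v, a, b` all
the other vertices have positive coordinates and lie beyond the line through `a` and `b`. -/
theorem ConvexIndependent.exists_neighbors {W : Finset Plane}
    (hW : ConvexIndependent ℝ (fun v : W => (v : Plane)))
    (hint : (interior (convexHull ℝ (W : Set Plane))).Nonempty) {v : Plane} (hv : v ∈ W) :
    ∃ a ∈ W, ∃ b ∈ W, 0 < cross (a - v) (b - v) ∧ ∀ w ∈ W, w ≠ v → w = a ∨ w = b ∨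
      ∃ α β : ℝ, 0 < α ∧ 0 < β ∧ 1 < α + β ∧ w = v + α • (a - v) + β • (b - v) := by
  classical
  set W' := W.erase v with hW'
  have hne : W'.Nonempty := by
    by_contra h
    rw [Finset.not_nonempty_iff_eq_empty, hW', Finset.erase_eq_empty_iff] at h
    rcases h with h | h <;> simp [h] at hint
  have hvW' : v ∉ convexHull ℝ (W' : Set Plane) :=
    hW.notMem_convexHull_of_subset hv (by simp [hW']) (by simp [hW'])
  obtain ⟨f, s, hfv, hfs⟩ := geometric_hahn_banach_point_closed (convex_convexHull ℝ _)
    (W'.finite_toSet.isClosed_convexHull ℝ) hvW'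
  set u : Plane := (InnerProductSpace.toDual ℝ Plane).symm f with hu
  have hfi : ∀ y, f y = inner ℝ u y := fun y => by
    rw [hu, InnerProductSpace.toDual_symm_apply]
  have hpos : ∀ w ∈ W', 0 < inner ℝ u (w - v) := fun w hw => by
    have := hfs w (subset_convexHull ℝ _ hw)
    rw [← hfi, map_sub]
    linarith
  -- Seen from `v`, all other vertices lie in the open half-plane of `u`, and the quotient is the
  -- tangent of the angle with `u`. Its extremes pick out the two neighbours.
  obtain ⟨a, ha, hamin⟩ := W'.exists_min_image (fun w => cross u (w - v) / inner ℝ u (w - v)) hne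
  obtain ⟨b, hb, hbmax⟩ := W'.exists_max_image (fun w => cross u (w - v) / inner ℝ u (w - v)) hne
  have huu : 0 < inner ℝ u u := by
    refine real_inner_self_pos.2 fun h0 => ?_
    have := hpos a ha
    rw [h0, inner_zero_left] at this
    exact this.false
  have hca : ∀ w ∈ W', 0 ≤ cross (a - v) (w - v) := fun w hw => by
    have h1 := hamin w hw
    rw [div_le_div_iff₀ (hpos a ha) (hpos w hw)] at h1
    have h2 := inner_self_mul_cross u (a - v) (w - v)
    by_contra! h
    nlinarith [mul_neg_of_pos_of_neg huu h]
  have hcb : ∀ w ∈ W', 0 ≤ cross (w - v) (b - v) := fun w hw => by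
    have h1 := hbmax w hw
    rw [div_le_div_iff₀ (hpos w hw) (hpos b hb)] at h1
    have h2 := inner_self_mul_cross u (w - v) (b - v)
    by_contra! h
    nlinarith [mul_neg_of_pos_of_neg huu h]
  have hav : a - v ≠ 0 := fun h0 => by simpa [h0] using hpos a ha
  have hD : 0 < cross (a - v) (b - v) := by
    refine (hca b hb).lt_of_ne' fun h0 => ?_
    set r := inner ℝ (a - v) (b - v) / inner ℝ (a - v) (a - v)
    have hr : b - v = r • (a - v) := eq_smul_of_cross_eq_zero hav h0
    have hr0 : 0 < r := by
      have h1 := hpos b hb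
      rw [hr, inner_smul_right] at h1
      exact pos_of_mul_pos_left h1 (hpos a ha).le
    have hline : ∀ w ∈ W, cross (a - v) w = cross (a - v) v := by
      intro w hw
      by_cases hwv : w = v
      · rw [hwv]
      have hw' : w ∈ W' := Finset.mem_erase.2 ⟨hwv, hw⟩
      have h1 := hca w hw'
      have h2 := hcb w hw'
      rw [hr, cross_smul_right, cross_swap] at h2
      have h3 : cross (a - v) (w - v) ≤ 0 := by
        by_contra! h
        nlinarith [mul_pos hr0 h]
      rw [cross_sub_right] at h1 h3
      linarith
    have hempty : interior (convexHull ℝ (W : Set Plane)) = ∅ := by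
      refine interior_eq_empty_of_cross_eq hav (r := cross (a - v) v) fun x hx => ?_
      have hconv : Convex ℝ {x | cross (a - v) x = cross (a - v) v} := by
        intro x hx y hy p q _ _ hpq
        simp only [Set.mem_ofPred_eq, cross, PiLp.add_apply, PiLp.smul_apply, smul_eq_mul] at hx hy ⊢
        linear_combination p * hx + q * hy + ((a - v) 0 * v 1 - (a - v) 1 * v 0) * hpq
      exact convexHull_min hline hconv hx
    rw [hempty] at hint
    exact Set.not_nonempty_empty hint
  have haW := Finset.mem_of_mem_erase ha
  have hbW := Finset.mem_of_mem_erase hb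
  have hav' : a ≠ v := sub_ne_zero.1 hav
  have hbv' : b ≠ v := Finset.ne_of_mem_erase hb
  refine ⟨a, haW, b, hbW, hD, fun w hw hwv => ?_⟩
  by_cases hwa : w = a
  · exact Or.inl hwa
  by_cases hwb : w = b
  · exact Or.inr (Or.inl hwb)
  refine Or.inr (Or.inr ?_)
  have hw' : w ∈ W' := Finset.mem_erase.2 ⟨hwv, hw⟩
  set α := cross (w - v) (b - v) / cross (a - v) (b - v) with hα
  set β := cross (a - v) (w - v) / cross (a - v) (b - v) with hβ
  have hα0 : 0 ≤ α := div_nonneg (hcb w hw') hD.le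
  have hβ0 : 0 ≤ β := div_nonneg (hca w hw') hD.le
  have hweq : w = v + α • (a - v) + β • (b - v) := by
    rw [hα, hβ, div_eq_inv_mul, div_eq_inv_mul, mul_smul, mul_smul, add_assoc, ← smul_add,
      ← cross_smul_eq, inv_smul_smul₀ hD.ne', add_sub_cancel]
  have h1 : 1 < α + β := by
    by_contra! hle
    refine hW.notMem_convexHull_of_subset (s := {v, a, b}) hw ?_ (by simp [hwv, hwa, hwb]) ?_
    · rintro t (rfl | rfl | rfl) <;> assumption
    · rw [convexHull_insert (by simp), convexHull_pair, mem_convexJoin]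
      rcases (add_nonneg hα0 hβ0).eq_or_lt with h0 | h0
      · have h2 : α = 0 := by linarith
        have h3 : β = 0 := by linarith
        rw [h2, h3] at hweq
        simp at hweq
        exact absurd hweq hwv
      · refine ⟨v, rfl, (α / (α + β)) • a + (β / (α + β)) • b,
          ⟨_, _, by positivity, by positivity, by field_simp, rfl⟩, 1 - (α + β), α + β,
          by linarith, h0.le, by ring, ?_⟩
        rw [smul_add, smul_smul, smul_smul, mul_div_cancel₀ _ h0.ne', mul_div_cancel₀ _ h0.ne']
        refine Eq.trans ?_ hweq.symm
        module
  -- If a coordinate vanished, one of the neighbours would lie on the segment from `v` to `w`,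
  -- because the other coordinate exceeds 1.
  refine ⟨α, β, hα0.lt_of_ne' fun h0 => ?_, hβ0.lt_of_ne' fun h0 => ?_, h1, hweq⟩
  · rw [h0, zero_add] at h1
    refine hW.notMem_segment hv hbW hw hbv' (Ne.symm hwb) ⟨1 - 1 / β, 1 / β, ?_, by positivity, by ring, ?_⟩
    · rw [sub_nonneg, div_le_one (by linarith)]; exact h1.le
    · rw [hweq, h0]
      match_scalars <;> field_simp <;> ring
  · rw [h0, add_zero] at h1
    refine hW.notMem_segment hv haW hw hav' (Ne.symm hwa) ⟨1 - 1 / α, 1 / α, ?_, by positivity, by ring, ?_⟩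
    · rw [sub_nonneg, div_le_one (by linarith)]; exact h1.le
    · rw [hweq, h0]
      match_scalars <;> field_simp <;> ring

/-! ### Area-preserving shears of a half-plane -/

section Shear

variable (ℓ : Plane →ᵃ[ℝ] ℝ) (d : Plane)

/-- The affine shear `x ↦ x + t ℓ(x) d`. -/
noncomputable def affineShear (t : ℝ) : Plane →ᵃ[ℝ] Plane :=
  AffineMap.id ℝ Plane + (LinearMap.toSpanSingleton ℝ Plane (t • d)).toAffineMap.comp ℓ

theorem affineShear_apply (t : ℝ) (x : Plane) : affineShear ℓ d t x = x + (ℓ x * t) • d := by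
  simp [affineShear, smul_smul]

/-- The shear `affineShear` on the half-plane `0 ≤ ℓ`, extended by the identity. -/
noncomputable def halfShear (t : ℝ) (x : Plane) : Plane := x + (max (ℓ x) 0 * t) • d

variable {ℓ d}

theorem halfShear_of_nonneg {t : ℝ} {x : Plane} (hx : 0 ≤ ℓ x) :
    halfShear ℓ d t x = affineShear ℓ d t x := by
  rw [halfShear, affineShear_apply, max_eq_left hx]

theorem halfShear_of_nonpos {t : ℝ} {x : Plane} (hx : ℓ x ≤ 0) : halfShear ℓ d t x = x := by
  rw [halfShear, max_eq_right hx, zero_mul, zero_smul, add_zero]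

theorem apply_add_smul_of_linear_eq_zero (hd : ℓ.linear d = 0) (x : Plane) (c : ℝ) :
    ℓ (x + c • d) = ℓ x := by
  rw [add_comm, ← vadd_eq_add, ℓ.map_vadd, map_smul, hd, smul_zero, zero_vadd]

theorem apply_halfShear (hd : ℓ.linear d = 0) (t : ℝ) (x : Plane) :
    ℓ (halfShear ℓ d t x) = ℓ x := apply_add_smul_of_linear_eq_zero hd x _

theorem halfShear_neg_halfShear (hd : ℓ.linear d = 0) (t : ℝ) (x : Plane) :
    halfShear ℓ d (-t) (halfShear ℓ d t x) = x := by
  rw [halfShear, apply_halfShear hd, halfShear]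
  module

/-- `halfShear` as a homeomorphism of the plane. -/
noncomputable def halfShearHomeomorph (hd : ℓ.linear d = 0) (t : ℝ) : Plane ≃ₜ Plane where
  toFun := halfShear ℓ d t
  invFun := halfShear ℓ d (-t)
  left_inv := halfShear_neg_halfShear hd t
  right_inv x := by simpa using halfShear_neg_halfShear hd (-t) x
  continuous_toFun := by
    have := ℓ.continuous_of_finiteDimensional
    unfold halfShear
    fun_prop
  continuous_invFun := by
    have := ℓ.continuous_of_finiteDimensional
    unfold halfShear
    fun_prop

theorem affineShear_injective (hd : ℓ.linear d = 0) (t : ℝ) :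
    Function.Injective (affineShear ℓ d t) := by
  refine Function.LeftInverse.injective (g := affineShear ℓ d (-t)) fun x => ?_
  rw [affineShear_apply, affineShear_apply, apply_add_smul_of_linear_eq_zero hd]
  module

theorem halfShear_image_of_nonneg {t : ℝ} {s : Set Plane} (hs : ∀ x ∈ s, 0 ≤ ℓ x) :
    halfShear ℓ d t '' s = affineShear ℓ d t '' s :=
  Set.image_congr fun x hx => halfShear_of_nonneg (hs x hx)

theorem halfShear_image_of_nonpos {t : ℝ} {s : Set Plane} (hs : ∀ x ∈ s, ℓ x ≤ 0) :
    halfShear ℓ d t '' s = s := by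
  rw [Set.image_congr fun x hx => halfShear_of_nonpos (hs x hx), Set.image_id']

/-- The shear preserves `ℓ`, so the two half-planes can be measured separately. -/
theorem measure_halfShear_image (μ : Measure Plane) (hd : ℓ.linear d = 0) (t : ℝ) (s : Set Plane) :
    μ (halfShear ℓ d t '' s) =
      μ (s ∩ {x | ℓ x ≤ 0}) + μ (affineShear ℓ d t '' (s ∩ {x | 0 < ℓ x})) := by
  have hm : MeasurableSet {x | ℓ x ≤ 0} :=
    (isClosed_le ℓ.continuous_of_finiteDimensional continuous_const).measurableSet
  rw [← measure_inter_add_sdiff (halfShear ℓ d t '' s) hm]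
  congr 2
  · rw [← halfShear_image_of_nonpos (ℓ := ℓ) (d := d) (t := t) (s := s ∩ {x | ℓ x ≤ 0})
      fun x hx => hx.2]
    ext y
    constructor
    · rintro ⟨⟨x, hx, rfl⟩, h⟩
      exact ⟨x, ⟨hx, (apply_halfShear hd t x).symm.le.trans h⟩, rfl⟩
    · rintro ⟨x, ⟨hx, h⟩, rfl⟩
      exact ⟨⟨x, hx, rfl⟩, (apply_halfShear hd t x).le.trans h⟩
  · rw [← halfShear_image_of_nonneg (ℓ := ℓ) (d := d) (t := t) (s := s ∩ {x | 0 < ℓ x})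
      fun x hx => hx.2.le]
    ext y
    constructor
    · rintro ⟨⟨x, hx, rfl⟩, h⟩
      exact ⟨x, ⟨hx, lt_of_not_ge fun h' => h ((apply_halfShear hd t x).le.trans h')⟩, rfl⟩
    · rintro ⟨x, ⟨hx, h⟩, rfl⟩
      exact ⟨⟨x, hx, rfl⟩, fun h' => (lt_of_lt_of_le h (apply_halfShear hd t x).symm.le).not_ge h'⟩

/-- The linear part is a transvection, of determinant 1 because `d` is in the kernel of the linear
part of `ℓ`. -/
theorem volume_affineShear_image (hd : ℓ.linear d = 0) (t : ℝ) (s : Set Plane) :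
    volume (affineShear ℓ d t '' s) = volume s := by
  have hlin : (affineShear ℓ d t).linear = LinearMap.transvection ℓ.linear (t • d) := by
    ext x : 1
    simp [affineShear, LinearMap.transvection.apply]
  have hdecomp : affineShear ℓ d t '' s =
      (fun y => affineShear ℓ d t 0 + y) '' ((affineShear ℓ d t).linear '' s) := by
    rw [Set.image_image]
    refine Set.image_congr fun x _ => ?_
    conv_lhs => rw [(affineShear ℓ d t).decomp]
    simp [add_comm]
  rw [hdecomp, Set.image_add_left, measure_preimage_add, addHaar_image_linearMap, hlin,
    LinearMap.transvection.det, map_smul, hd]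
  simp

theorem volume_halfShear_image (hd : ℓ.linear d = 0) (t : ℝ) (s : Set Plane) :
    volume (halfShear ℓ d t '' s) = volume s := by
  have hm : MeasurableSet {x | ℓ x ≤ 0} :=
    (isClosed_le ℓ.continuous_of_finiteDimensional continuous_const).measurableSet
  rw [measure_halfShear_image volume hd, volume_affineShear_image hd,
    ← measure_inter_add_sdiff s hm]
  congr 2
  ext x
  simp

end Shear

/-! ### Sliding a vertex parallel to the line through its neighbours -/

/-- Every point of `s` has nonnegative coordinates in the affine frame `v, a, b` and is separated
from `v` by the line through `a` and `b`. -/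
def BeyondLine (v a b : Plane) (s : Set Plane) : Prop :=
  ∀ w ∈ s, ∃ α β : ℝ, 0 ≤ α ∧ 0 ≤ β ∧ 1 ≤ α + β ∧ w = v + α • (a - v) + β • (b - v)

theorem BeyondLine.convexHull {v a b : Plane} {s : Set Plane} (h : BeyondLine v a b s) :
    BeyondLine v a b (convexHull ℝ s) := by
  refine convexHull_min h ?_
  rintro _ ⟨α, β, hα, hβ, hαβ, rfl⟩ _ ⟨α', β', hα', hβ', hαβ', rfl⟩ p q hp hq hpq
  refine ⟨p * α + q * α', p * β + q * β', by positivity, by positivity, by nlinarith, ?_⟩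
  obtain rfl : q = 1 - p := by linarith
  module

theorem mem_convexHull_triple {v a b : Plane} {α β : ℝ} (hα : 0 ≤ α) (hβ : 0 ≤ β) (h : α + β ≤ 1) :
    v + α • (a - v) + β • (b - v) ∈ convexHull ℝ {v, a, b} := by
  have hc := convex_convexHull ℝ ({v, a, b} : Set Plane)
  have hv : v ∈ convexHull ℝ ({v, a, b} : Set Plane) := subset_convexHull ℝ _ (by simp)
  have ha : a ∈ convexHull ℝ ({v, a, b} : Set Plane) := subset_convexHull ℝ _ (by simp)
  have hb : b ∈ convexHull ℝ ({v, a, b} : Set Plane) := subset_convexHull ℝ _ (by simp)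
  have := hc.sum_mem (t := Finset.univ) (w := ![1 - α - β, α, β]) (z := ![v, a, b])
    (by intro i _; fin_cases i <;> simp <;> linarith) (by simp [Fin.sum_univ_three]; ring)
    (by intro i _; fin_cases i <;> simpa)
  rw [Fin.sum_univ_three] at this
  convert! this using 1
  simp
  module

/-- A segment from `v` to a point of the hull of `s` runs in the triangle until it meets the line
through `a` and `b`, and in the hull of `s` afterwards. -/
theorem BeyondLine.convexHull_insert {v a b : Plane} {s : Set Plane} (h : BeyondLine v a b s)
    (ha : a ∈ s) (hb : b ∈ s) :
    _root_.convexHull ℝ (insert v s) = _root_.convexHull ℝ {v, a, b} ∪ _root_.convexHull ℝ s := by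
  refine Set.Subset.antisymm ?_ (Set.union_subset (convexHull_mono ?_) (convexHull_mono (by simp)))
  · rw [_root_.convexHull_insert ⟨a, ha⟩]
    intro x hx
    obtain ⟨v', hv', r, hr, hx⟩ := mem_convexJoin.1 hx
    rw [Set.mem_singleton_iff] at hv'
    rw [hv'] at hx
    obtain ⟨α, β, hα, hβ, hαβ, hreq⟩ := h.convexHull r hr
    obtain ⟨p, q, hp, hq, hpq, rfl⟩ := hx
    obtain rfl : p = 1 - q := by linarith
    rcases le_total (q * (α + β)) 1 with hle | hle
    · left
      have hmem := mem_convexHull_triple (v := v) (a := a) (b := b) (mul_nonneg hq hα)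
        (mul_nonneg hq hβ) (by linarith)
      rw [hreq]
      convert! hmem using 1
      module
    · right
      have hS : 0 < α + β := by linarith
      -- The point where the ray from `v` to `r` crosses the line through `a` and `b`.
      have hy : (α / (α + β)) • a + (β / (α + β)) • b ∈ _root_.convexHull ℝ s :=
        convex_convexHull ℝ s (subset_convexHull ℝ s ha) (subset_convexHull ℝ s hb)
          (by positivity) (by positivity) (by field_simp)
      rcases hαβ.eq_or_lt with h1 | h1
      · obtain rfl : q = 1 := by
          rw [← h1, mul_one] at hle
          linarith
        simpa using hr
      · have h1' : 0 < α + β - 1 := by linarith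
        have hmem := convex_convexHull ℝ s hy hr
          (a := (1 - q) * (α + β) / (α + β - 1)) (b := (q * (α + β) - 1) / (α + β - 1))
          (div_nonneg (mul_nonneg hp hS.le) h1'.le) (div_nonneg (by linarith) h1'.le)
          (by field_simp; ring)
        convert! hmem using 1
        rw [hreq]
        match_scalars <;> field_simp <;> ring
  · rintro t (rfl | rfl | rfl)
    · simp
    · exact Set.mem_insert_of_mem _ ha
    · exact Set.mem_insert_of_mem _ hb

theorem exists_affineBasis_of_cross_pos {v a b : Plane} (h : 0 < cross (a - v) (b - v)) :
    ∃ B : AffineBasis (Fin 3) ℝ Plane, B 0 = v ∧ B 1 = a ∧ B 2 = b := by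
  have hind : AffineIndependent ℝ ![v, a, b] := by
    rw [affineIndependent_iff_not_collinear_set, collinear_iff_of_mem (p₀ := v) (by simp)]
    rintro ⟨d, hd⟩
    obtain ⟨r, hr⟩ := hd a (by simp)
    obtain ⟨s, hs⟩ := hd b (by simp)
    refine h.ne' ?_
    rw [hr, hs]
    simp [cross]
    ring
  exact ⟨⟨![v, a, b], hind, hind.affineSpan_eq_top_iff_card_eq_finrank_add_one.2 (by simp)⟩,
    rfl, rfl, rfl⟩

section Basis

variable (B : AffineBasis (Fin 3) ℝ Plane)

theorem AffineBasis.coord_zero_linear_eq_zero : (B.coord 0).linear (B 2 - B 1) = 0 := by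
  rw [← vsub_eq_sub, AffineMap.linearMap_vsub, B.coord_apply_ne (by decide),
    B.coord_apply_ne (by decide), vsub_self]

variable {B}

theorem BeyondLine.coord_zero_nonpos {s : Set Plane} (h : BeyondLine (B 0) (B 1) (B 2) s) {w : Plane}
    (hw : w ∈ s) : B.coord 0 w ≤ 0 := by
  obtain ⟨α, β, -, -, hαβ, rfl⟩ := h w hw
  have h1 : B.coord 0 (B 0 + α • (B 1 - B 0) + β • (B 2 - B 0)) = 1 - α - β := by
    rw [add_assoc, add_comm, ← vadd_eq_add, AffineMap.map_vadd, map_add, map_smul, map_smul,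
      ← vsub_eq_sub, ← vsub_eq_sub, AffineMap.linearMap_vsub, AffineMap.linearMap_vsub,
      B.coord_apply_eq, B.coord_apply_ne (by decide), B.coord_apply_ne (by decide)]
    simp
    ring
  linarith

theorem AffineBasis.range_eq_triple : Set.range B = {B 0, B 1, B 2} := by
  ext x
  simp [Fin.exists_fin_succ, eq_comm]

theorem AffineBasis.coord_of_mem_segment {i j k : Fin 3} {x : Plane} (hx : x ∈ segment ℝ (B j) (B k)) :
    ∃ p q : ℝ, 0 ≤ p ∧ 0 ≤ q ∧ p + q = 1 ∧ x = p • B j + q • B k ∧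
      B.coord i x = p * (if i = j then 1 else 0) + q * (if i = k then 1 else 0) := by
  obtain ⟨p, q, hp, hq, hpq, rfl⟩ := hx
  refine ⟨p, q, hp, hq, hpq, rfl, ?_⟩
  rw [Convex.combo_affine_apply hpq, B.coord_apply, B.coord_apply]
  simp

/-- The frontier is local: in this open half-plane `P` coincides with the triangle. -/
theorem AffineBasis.frontier_inter_coord_pos {P R : Set Plane}
    (hP : P = convexHull ℝ {B 0, B 1, B 2} ∪ R) (hR : ∀ x ∈ R, B.coord 0 x ≤ 0) :
    frontier P ∩ {x | 0 < B.coord 0 x} =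
      (segment ℝ (B 0) (B 1) ∪ segment ℝ (B 0) (B 2)) ∩ {x | 0 < B.coord 0 x} := by
  have hU : IsOpen {x | 0 < B.coord 0 x} :=
    isOpen_lt continuous_const (B.coord 0).continuous_of_finiteDimensional
  have hPU : P ∩ {x | 0 < B.coord 0 x} = convexHull ℝ (Set.range B) ∩ {x | 0 < B.coord 0 x} := by
    rw [hP, B.range_eq_triple, Set.union_inter_distrib_right, Set.union_eq_left]
    exact fun x hx => absurd hx.2 (not_lt.2 (hR x hx.1))
  rw [← frontier_inter_open_inter hU, hPU, frontier_inter_open_inter hU,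
    frontier_convexHull_affineBasis]
  ext x
  refine and_congr_left fun hx => ⟨?_, ?_⟩
  · rintro ⟨hx0, i, hi⟩
    fin_cases i
    · exact absurd hi hx.ne'
    · exact Or.inr (B.mem_segment_of_coord_eq_zero (by decide) (by decide) (by decide) hx0 hi)
    · exact Or.inl (B.mem_segment_of_coord_eq_zero (by decide) (by decide) (by decide) hx0 hi)
  · rintro (h | h)
    · refine ⟨fun i => ?_, 2, ?_⟩
      · obtain ⟨p, q, hp, hq, -, -, he⟩ := B.coord_of_mem_segment (i := i) h
        rw [he]
        positivity
      · obtain ⟨p, q, -, -, -, -, he⟩ := B.coord_of_mem_segment (i := 2) h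
        rw [he]
        simp
    · refine ⟨fun i => ?_, 1, ?_⟩
      · obtain ⟨p, q, hp, hq, -, -, he⟩ := B.coord_of_mem_segment (i := i) h
        rw [he]
        positivity
      · obtain ⟨p, q, -, -, -, -, he⟩ := B.coord_of_mem_segment (i := 1) h
        rw [he]
        simp

theorem AffineBasis.segment_inter_coord_pos {k : Fin 3} (hk : k ≠ 0) :
    segment ℝ (B 0) (B k) ∩ {x | 0 < B.coord 0 x} = segment ℝ (B 0) (B k) \ {B k} := by
  ext x
  refine and_congr_right fun h => ?_
  obtain ⟨p, q, hp, hq, hpq, hx, he⟩ := B.coord_of_mem_segment (i := 0) h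
  rw [if_pos rfl, if_neg hk.symm, mul_one, mul_zero, add_zero] at he
  rw [Set.mem_ofPred_eq, Set.mem_singleton_iff, he]
  constructor
  · rintro hp0 rfl
    rw [B.coord_apply_ne hk.symm] at he
    exact hp0.ne he
  · intro hne
    refine hp.lt_of_ne' fun h0 => hne ?_
    rw [hx, h0, show q = 1 by linarith]
    simp

theorem AffineBasis.segment_inter_segment :
    segment ℝ (B 0) (B 1) ∩ segment ℝ (B 0) (B 2) ⊆ {B 0} := by
  rintro x ⟨h1, h2⟩
  obtain ⟨p, q, -, -, hpq, hx, -⟩ := B.coord_of_mem_segment (i := 1) h1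
  obtain ⟨p', q', -, -, -, -, he'⟩ := B.coord_of_mem_segment (i := 1) h2
  obtain ⟨p'', q'', -, -, hpq'', hx'', he⟩ := B.coord_of_mem_segment (i := 1) h1
  simp at he he'
  rw [Set.mem_singleton_iff, hx'', ← he, he', show p'' = 1 by linarith]
  simp

theorem AffineBasis.hausdorffMeasure_image_segments {S : Plane →ᵃ[ℝ] Plane}
    (hS : Function.Injective S) :
    μH[1] (S '' ((segment ℝ (B 0) (B 1) ∪ segment ℝ (B 0) (B 2)) ∩ {x | 0 < B.coord 0 x})) =
      edist (S (B 0)) (S (B 1)) + edist (S (B 0)) (S (B 2)) := by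
  have hnull : ∀ x : Plane, (μH[1] : Measure Plane) {x} = 0 := fun x => by
    have := nullSingletonClass_hausdorff Plane zero_lt_one
    exact measure_singleton x
  rw [Set.union_inter_distrib_right, B.segment_inter_coord_pos (by decide),
    B.segment_inter_coord_pos (by decide), Set.image_union, Set.image_sdiff hS, Set.image_sdiff hS,
    image_segment, image_segment, Set.image_singleton, Set.image_singleton, measure_union₀]
  · rw [measure_sdiff_null (hnull _), measure_sdiff_null (hnull _), hausdorffMeasure_segment,
      hausdorffMeasure_segment]
  · refine MeasurableSet.nullMeasurableSet (MeasurableSet.diff ?_ (measurableSet_singleton _))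
    rw [← convexHull_pair]
    exact ((Set.toFinite _).isClosed_convexHull ℝ).measurableSet
  · refine measure_mono_null ?_ (hnull (S (B 0)))
    rw [← image_segment, ← image_segment]
    rintro _ ⟨⟨⟨x, hx, rfl⟩, -⟩, ⟨y, hy, hxy⟩, -⟩
    obtain rfl := hS hxy
    rw [B.segment_inter_segment ⟨hx, hy⟩]
    rfl

/-- Moving the vertex `B 0` of a polygon parallel to the line through its neighbours. -/
theorem BeyondLine.perimeter_convexHull_insert {s : Set Plane} (h : BeyondLine (B 0) (B 1) (B 2) s)
    (ha : B 1 ∈ s) (hb : B 2 ∈ s) {t : ℝ}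
    (ht : BeyondLine (B 0 + t • (B 2 - B 1)) (B 1) (B 2) s) :
    volume (_root_.convexHull ℝ (insert (B 0 + t • (B 2 - B 1)) s)) =
      volume (_root_.convexHull ℝ (insert (B 0) s)) ∧
    perimeter (_root_.convexHull ℝ (insert (B 0 + t • (B 2 - B 1)) s)) =
      μH[1] (frontier (_root_.convexHull ℝ (insert (B 0) s)) ∩ {x | B.coord 0 x ≤ 0}) +
        (edist (B 0 + t • (B 2 - B 1)) (B 1) + edist (B 0 + t • (B 2 - B 1)) (B 2)) := by
  have hd := B.coord_zero_linear_eq_zero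
  have hP := h.convexHull_insert ha hb
  have hR : ∀ x ∈ _root_.convexHull ℝ s, B.coord 0 x ≤ 0 := fun x hx =>
    h.convexHull.coord_zero_nonpos hx
  have hS : ∀ i, affineShear (B.coord 0) (B 2 - B 1) t (B i) =
      B i + ((if 0 = i then 1 else 0) * t) • (B 2 - B 1) := fun i => by
    rw [affineShear_apply, B.coord_apply]
  have hS0 : affineShear (B.coord 0) (B 2 - B 1) t (B 0) = B 0 + t • (B 2 - B 1) := by
    rw [hS]; simp
  have hS1 : affineShear (B.coord 0) (B 2 - B 1) t (B 1) = B 1 := by rw [hS]; simp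
  have hS2 : affineShear (B.coord 0) (B 2 - B 1) t (B 2) = B 2 := by rw [hS]; simp
  -- The half-plane shear moves only the triangle at `B 0` and fixes the rest, hence it carries the
  -- old polygon to the new one.
  have himage : halfShear (B.coord 0) (B 2 - B 1) t '' (_root_.convexHull ℝ (insert (B 0) s)) =
      _root_.convexHull ℝ (insert (B 0 + t • (B 2 - B 1)) s) := by
    rw [hP, ht.convexHull_insert ha hb, Set.image_union, halfShear_image_of_nonpos hR,
      halfShear_image_of_nonneg, AffineMap.image_convexHull, Set.image_insert_eq, Set.image_pair,
      hS0, hS1, hS2]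
    intro x hx
    rw [← B.range_eq_triple, B.convexHull_eq_nonneg_coord] at hx
    exact hx 0
  rw [← himage]
  refine ⟨volume_halfShear_image hd t _, ?_⟩
  have hfr := (halfShearHomeomorph hd t).image_frontier (_root_.convexHull ℝ (insert (B 0) s))
  change halfShear (B.coord 0) (B 2 - B 1) t '' _ =
    frontier (halfShear (B.coord 0) (B 2 - B 1) t '' _) at hfr
  rw [perimeter, ← hfr, measure_halfShear_image _ hd, B.frontier_inter_coord_pos hP hR,
    B.hausdorffMeasure_image_segments (affineShear_injective hd t), hS0, hS1, hS2]

end Basis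

/-! ### Optimal polygons are inscribed -/

theorem SameRay.cross_eq_zero {x y : Plane} (h : SameRay ℝ x y) : cross x y = 0 := by
  rcases h with rfl | rfl | ⟨r, s, hr, hs, h⟩
  · simp [cross]
  · simp [cross]
  · have h1 : s * cross x y = 0 := by
      rw [← cross_smul_right, ← h, cross_smul_right]
      simp [cross]
      right; ring
    exact (mul_eq_zero.1 h1).resolve_left hs.ne'

/-- Strict triangle inequality: `v - a` is the midpoint of two vectors that are not parallel. -/
theorem two_mul_dist_lt {v a d : Plane} {t : ℝ} (ht : t ≠ 0) (h : cross (v - a) d ≠ 0) :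
    2 * dist v a < dist (v + t • d) a + dist (v + (-t) • d) a := by
  have h1 : ¬ SameRay ℝ (v + t • d - a) (v + (-t) • d - a) := fun hr => by
    have h2 := hr.cross_eq_zero
    have h3 : t * cross (v - a) d = 0 := by
      simp only [cross, PiLp.sub_apply, PiLp.add_apply, PiLp.smul_apply, smul_eq_mul] at h2 ⊢
      linear_combination (-1 / 2) * h2
    exact (mul_ne_zero ht h) h3
  have h2 := norm_add_lt_of_not_sameRay h1
  rw [show v + t • d - a + (v + (-t) • d - a) = (2 : ℝ) • (v - a) by module, norm_smul] at h2
  simpa [dist_eq_norm] using h2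

open Filter Topology in
/-- The vertices of a polygon of maximal perimeter, among the polygons in `Ω` with the same area and
no more vertices, lie on the boundary of `Ω`. -/
theorem ConvexIndependent.mem_frontier_of_perimeter_max {Ω : Set Plane} {W : Finset Plane}
    (hW : ConvexIndependent ℝ (fun v : W => (v : Plane)))
    (hint : (interior (convexHull ℝ (W : Set Plane))).Nonempty) (hWΩ : (W : Set Plane) ⊆ Ω)
    (hmax : ∀ S : Finset Plane, (S : Set Plane) ⊆ Ω → S.card ≤ W.card →
      volume (convexHull ℝ (S : Set Plane)) = volume (convexHull ℝ (W : Set Plane)) →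
      perimeter (convexHull ℝ (S : Set Plane)) ≤ perimeter (convexHull ℝ (W : Set Plane)))
    {v : Plane} (hv : v ∈ W) : v ∈ frontier Ω := by
  classical
  refine ⟨subset_closure (hWΩ hv), fun hvint => ?_⟩
  obtain ⟨a, ha, b, hb, hD, hcone⟩ := hW.exists_neighbors hint hv
  obtain ⟨B, rfl, rfl, rfl⟩ := exists_affineBasis_of_cross_pos hD
  set s : Set Plane := ((W.erase (B 0) : Finset Plane) : Set Plane) with hs
  have hav : B 1 ≠ B 0 := B.ind.injective.ne (by decide)
  have hbv : B 2 ≠ B 0 := B.ind.injective.ne (by decide)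
  have has : B 1 ∈ s := Finset.mem_coe.2 (Finset.mem_erase.2 ⟨hav, ha⟩)
  have hbs : B 2 ∈ s := Finset.mem_coe.2 (Finset.mem_erase.2 ⟨hbv, hb⟩)
  -- In the frame of the moved apex the coordinates become α + t(1 - α - β) and β - t(1 - α - β).
  -- Their sum is unchanged, and strict positivity persists for small t.
  have hbeyond : ∀ᶠ t : ℝ in 𝓝 0, BeyondLine (B 0 + t • (B 2 - B 1)) (B 1) (B 2) s := by
    refine (eventually_all_finset (W.erase (B 0))).2 fun w hw => ?_
    rcases hcone w (Finset.mem_of_mem_erase hw) (Finset.ne_of_mem_erase hw) with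
      rfl | rfl | ⟨α, β, hα, hβ, hαβ, hweq⟩
    · exact Eventually.of_forall fun t => ⟨1, 0, by simp⟩
    · exact Eventually.of_forall fun t => ⟨0, 1, by simp⟩
    · have h1 : ∀ᶠ t : ℝ in 𝓝 0, 0 < α + t - t * (α + β) := by
        refine ContinuousAt.eventually_lt (by fun_prop) (by fun_prop) ?_
        simpa
      have h2 : ∀ᶠ t : ℝ in 𝓝 0, 0 < β - t + t * (α + β) := by
        refine ContinuousAt.eventually_lt (by fun_prop) (by fun_prop) ?_
        simpa
      filter_upwards [h1, h2] with t h1 h2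
      refine ⟨_, _, h1.le, h2.le, by linarith, ?_⟩
      rw [hweq]
      module
  have hmem : ∀ᶠ t : ℝ in 𝓝 0, B 0 + t • (B 2 - B 1) ∈ Ω := by
    have hc : ContinuousAt (fun t : ℝ => B 0 + t • (B 2 - B 1)) 0 := by fun_prop
    refine hc.eventually_mem ?_
    rw [zero_smul, add_zero]
    exact mem_interior_iff_mem_nhds.1 hvint
  have hinsert : insert (B 0) s = (W : Set Plane) := by
    rw [hs, ← Finset.coe_insert, Finset.insert_erase hv]
  have hbeyond0 : BeyondLine (B 0) (B 1) (B 2) s := by simpa using hbeyond.self_of_nhds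
  -- The slide by 0 expresses the original perimeter with the same constant part, which cancels in
  -- the comparison.
  have hP := hbeyond0.perimeter_convexHull_insert has hbs (t := 0) (by simpa using hbeyond0)
  rw [zero_smul, add_zero, hinsert] at hP
  set C := μH[1] (frontier (convexHull ℝ (W : Set Plane)) ∩ {x | B.coord 0 x ≤ 0})
  have hCfin : C ≠ ⊤ := ((measure_mono Set.inter_subset_left).trans_lt (perimeter_lt_top
    (convex_convexHull ℝ _) (W.finite_toSet.isCompact_convexHull ℝ) hint)).ne
  have hle : ∀ t : ℝ, BeyondLine (B 0 + t • (B 2 - B 1)) (B 1) (B 2) s → B 0 + t • (B 2 - B 1) ∈ Ω →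
      dist (B 0 + t • (B 2 - B 1)) (B 1) + dist (B 0 + t • (B 2 - B 1)) (B 2) ≤
        dist (B 0) (B 1) + dist (B 0) (B 2) := by
    intro t ht htΩ
    obtain ⟨hvol, hper⟩ := hbeyond0.perimeter_convexHull_insert has hbs ht
    rw [hinsert] at hvol hper
    have hcoe : ((insert (B 0 + t • (B 2 - B 1)) (W.erase (B 0)) : Finset Plane) : Set Plane) =
        insert (B 0 + t • (B 2 - B 1)) s := by rw [Finset.coe_insert]
    have h1 := hmax (insert (B 0 + t • (B 2 - B 1)) (W.erase (B 0))) ?_ ?_ ?_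
    · rw [hcoe, hper, hP.2, ENNReal.add_le_add_iff_left hCfin] at h1
      simp only [edist_dist] at h1
      rwa [← ENNReal.ofReal_add dist_nonneg dist_nonneg, ← ENNReal.ofReal_add dist_nonneg dist_nonneg,
        ENNReal.ofReal_le_ofReal_iff (by positivity)] at h1
    · rw [hcoe]
      exact Set.insert_subset htΩ fun x hx => hWΩ (Finset.mem_of_mem_erase hx)
    · refine (Finset.card_insert_le _ _).trans ?_
      rw [Finset.card_erase_of_mem hv]
      have := Finset.card_pos.2 ⟨_, hv⟩
      omega
    · rw [hcoe, hvol]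
  have hgood := hbeyond.and hmem
  have hneg : Tendsto (fun t : ℝ => -t) (𝓝 0) (𝓝 0) := by simpa using (continuous_neg (G := ℝ)).tendsto 0
  obtain ⟨t, ⟨h1, h2⟩, ht⟩ := (((hgood.and (hneg.eventually hgood)).filter_mono
    nhdsWithin_le_nhds).and (self_mem_nhdsWithin : {(0 : ℝ)}ᶜ ∈ 𝓝[≠] 0)).exists
  have hcr1 : cross (B 0 - B 1) (B 2 - B 1) ≠ 0 := by
    have : cross (B 0 - B 1) (B 2 - B 1) = -cross (B 1 - B 0) (B 2 - B 0) := by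
      simp [cross]; ring
    rw [this]
    exact neg_ne_zero.2 hD.ne'
  have hcr2 : cross (B 0 - B 2) (B 2 - B 1) ≠ 0 := by
    have : cross (B 0 - B 2) (B 2 - B 1) = -cross (B 1 - B 0) (B 2 - B 0) := by
      simp [cross]; ring
    rw [this]
    exact neg_ne_zero.2 hD.ne'
  linarith [hle t h1.1 h1.2, hle (-t) h2.1 h2.2, two_mul_dist_lt ht hcr1, two_mul_dist_lt ht hcr2]

/-! ### From polygons to arbitrary convex sets -/

/-- A polygon in a larger polygon can be enlarged to a polygon of any intermediate area. -/
theorem exists_superset_volume_eq {S V : Finset Plane}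
    (hSV : (S : Set Plane) ⊆ convexHull ℝ (V : Set Plane))
    (hint : (interior (convexHull ℝ (S : Set Plane))).Nonempty) {a : ENNReal}
    (ha : volume (convexHull ℝ (S : Set Plane)) ≤ a) (ha' : a ≤ volume (convexHull ℝ (V : Set Plane))) :
    ∃ S' : Finset Plane, (S' : Set Plane) ⊆ convexHull ℝ (V : Set Plane) ∧
      volume (convexHull ℝ (S' : Set Plane)) = a ∧
      convexHull ℝ (S : Set Plane) ⊆ convexHull ℝ (S' : Set Plane) := by
  classical
  have hSne : S.Nonempty := by
    by_contra h
    rw [Finset.not_nonempty_iff_eq_empty] at h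
    simp [h] at hint
  have hVne : V.Nonempty := by
    by_contra h
    rw [Finset.not_nonempty_iff_eq_empty] at h
    obtain ⟨x, hx⟩ := hSne
    simpa [h] using hSV hx
  obtain ⟨s₀, hs₀⟩ := hSne
  obtain ⟨v₀, hv₀⟩ := hVne
  -- The points s + t(v - s) interpolate between `S` at t = 0 and `V` at t = 1. Each intermediate
  -- hull contains `S`, so it stays non-degenerate and the intermediate value theorem applies to the
  -- area.
  let q : ℝ → S × V → Plane := fun t p => AffineMap.homothety (p.1 : Plane) t (p.2 : Plane)
  have hq : Continuous q := by
    simp only [q, AffineMap.homothety_apply]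
    fun_prop
  have hsub : ∀ t, convexHull ℝ (S : Set Plane) ⊆ convexHull ℝ (Set.range (q t)) := by
    refine fun t => convexHull_min (fun s hs => ?_) (convex_convexHull ℝ _)
    have h1 : AffineMap.homothety s t '' convexHull ℝ (V : Set Plane) ⊆
        convexHull ℝ (Set.range (q t)) := by
      rw [AffineMap.image_convexHull]
      refine convexHull_mono ?_
      rintro _ ⟨v, hv, rfl⟩
      exact ⟨(⟨s, hs⟩, ⟨v, hv⟩), rfl⟩
    exact h1 ⟨s, hSV hs, AffineMap.homothety_apply_same s t⟩
  have hcont : ContinuousOn (fun t => volume (convexHull ℝ (Set.range (q t)))) (Set.Icc 0 1) :=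
    fun t _ => ((continuousAt_volume_convexHull_range (hint.mono (interior_mono (hsub t)))).comp
      (f := q) hq.continuousAt).continuousWithinAt
  have h0 : Set.range (q 0) = S := by
    ext x
    constructor
    · rintro ⟨p, rfl⟩
      simp [q]
    · exact fun hx => ⟨(⟨x, hx⟩, ⟨v₀, hv₀⟩), by simp [q]⟩
  have h1 : Set.range (q 1) = V := by
    ext x
    constructor
    · rintro ⟨p, rfl⟩
      simp [q]
    · exact fun hx => ⟨(⟨s₀, hs₀⟩, ⟨x, hx⟩), by simp [q]⟩
  obtain ⟨t, ht, hta⟩ := intermediate_value_Icc zero_le_one hcont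
    (show a ∈ Set.Icc (volume (convexHull ℝ (Set.range (q 0))))
      (volume (convexHull ℝ (Set.range (q 1)))) by rw [h0, h1]; exact ⟨ha, ha'⟩)
  refine ⟨Finset.univ.image (q t), ?_⟩
  rw [Finset.coe_image, Finset.coe_univ, Set.image_univ]
  refine ⟨?_, hta, hsub t⟩
  rintro _ ⟨p, rfl⟩
  simp only [q, AffineMap.homothety_eq_lineMap]
  exact (convex_convexHull ℝ _).lineMap_mem (hSV p.1.2) (subset_convexHull ℝ _ p.2.2) ht

theorem exists_card_le_volume_eq {V : Finset Plane}
    (hint : (interior (convexHull ℝ (V : Set Plane))).Nonempty) {A : ℝ} (hA : 0 < A)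
    (hAV : ENNReal.ofReal A < volume (convexHull ℝ (V : Set Plane))) :
    ∃ S : Finset Plane, (S : Set Plane) ⊆ convexHull ℝ (V : Set Plane) ∧ S.card ≤ V.card ∧
      volume (convexHull ℝ (S : Set Plane)) = ENNReal.ofReal A := by
  classical
  obtain ⟨c, hc⟩ := hint
  have hfin : volume (convexHull ℝ (V : Set Plane)) ≠ ⊤ :=
    (V.finite_toSet.isCompact_convexHull ℝ).measure_ne_top
  set M := (volume (convexHull ℝ (V : Set Plane))).toReal with hM
  have hMV : ENNReal.ofReal M = volume (convexHull ℝ (V : Set Plane)) := ENNReal.ofReal_toReal hfin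
  have hAM : A < M := by
    rw [← hMV, ENNReal.ofReal_lt_ofReal_iff'] at hAV
    exact hAV.1
  have hM0 : 0 < M := hA.trans hAM
  have hr1 : √(A / M) ≤ 1 := Real.sqrt_le_one.2 ((div_le_one hM0).2 hAM.le)
  refine ⟨V.image (AffineMap.homothety c √(A / M)), ?_, Finset.card_image_le, ?_⟩
  · rw [Finset.coe_image]
    rintro _ ⟨v, hv, rfl⟩
    rw [AffineMap.homothety_eq_lineMap]
    exact (convex_convexHull ℝ _).lineMap_mem (interior_subset hc) (subset_convexHull ℝ _ hv)
      ⟨Real.sqrt_nonneg _, hr1⟩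
  · rw [Finset.coe_image, ← AffineMap.image_convexHull, addHaar_image_homothety,
      finrank_euclideanSpace_fin, Real.sq_sqrt (by positivity), abs_of_pos (by positivity), ← hMV,
      ← ENNReal.ofReal_mul (by positivity), div_mul_cancel₀ _ hM0.ne']

theorem exists_convexIndependent_convexHull_eq (S : Finset Plane) :
    ∃ W ⊆ S, ConvexIndependent ℝ (fun v : W => (v : Plane)) ∧
      convexHull ℝ (W : Set Plane) = convexHull ℝ (S : Set Plane) := by
  classical
  set E := (convexHull ℝ (S : Set Plane)).extremePoints ℝ with hE
  have hES : E ⊆ S := extremePoints_convexHull_subset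
  obtain ⟨W, hW⟩ := (S.finite_toSet.subset hES).exists_finset_coe
  refine ⟨W, Finset.coe_subset.1 (hW ▸ hES), ?_, ?_⟩
  · have := (convex_convexHull ℝ (S : Set Plane)).convexIndependent_extremePoints
    rw [← hE, ← hW] at this
    exact this
  · have := closure_convexHull_extremePoints (S.finite_toSet.isCompact_convexHull ℝ)
      (convex_convexHull ℝ (S : Set Plane))
    rwa [← hE, ← hW, (W.finite_toSet.isClosed_convexHull ℝ).closure_eq] at this

/-- Among the polygons of given area with at most `N` vertices in a convex `n`-gon, there is an
inscribed one with at most `2 * n` vertices and maximal perimeter. -/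
theorem exists_inscribed_perimeter_max {V : Finset Plane}
    (hint : (interior (convexHull ℝ (V : Set Plane))).Nonempty) {A : ℝ} (hA : 0 < A)
    (hAV : ENNReal.ofReal A < volume (convexHull ℝ (V : Set Plane))) {N : ℕ} (hN : V.card ≤ N) :
    ∃ W : Finset Plane, ConvexIndependent ℝ (fun v : W => (v : Plane)) ∧
      (∀ w ∈ W, w ∈ frontier (convexHull ℝ (V : Set Plane))) ∧ W.card ≤ 2 * V.card ∧
      volume (convexHull ℝ (W : Set Plane)) = ENNReal.ofReal A ∧
      ∀ S : Finset Plane, (S : Set Plane) ⊆ convexHull ℝ (V : Set Plane) → S.card ≤ N →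
        volume (convexHull ℝ (S : Set Plane)) = ENNReal.ofReal A →
        perimeter (convexHull ℝ (S : Set Plane)) ≤ perimeter (convexHull ℝ (W : Set Plane)) := by
  have ha : ENNReal.ofReal A ≠ 0 := (ENNReal.ofReal_pos.2 hA).ne'
  obtain ⟨S₀, hS₀, hS₀V, hS₀A⟩ := exists_card_le_volume_eq hint hA hAV
  obtain ⟨S, hSV, hSN, hSA, hmax⟩ := exists_perimeter_max_card_le
    (V.finite_toSet.isCompact_convexHull ℝ) ha N ⟨S₀, hS₀, hS₀V.trans hN, hS₀A⟩
  obtain ⟨W, hWS, hW, hWhull⟩ := exists_convexIndependent_convexHull_eq S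
  have hWint : (interior (convexHull ℝ (W : Set Plane))).Nonempty := by
    refine (convex_convexHull ℝ _).interior_nonempty_of_volume_ne_zero ?_
    rwa [hWhull, hSA]
  have hfr : ∀ w ∈ W, w ∈ frontier (convexHull ℝ (V : Set Plane)) := fun w hw => by
    refine hW.mem_frontier_of_perimeter_max hWint ((Finset.coe_subset.2 hWS).trans hSV) ?_ hw
    intro S' hS' hS'W hS'A
    rw [hWhull] at hS'A ⊢
    exact hmax S' hS' (hS'W.trans ((Finset.card_le_card hWS).trans hSN)) (hS'A.trans hSA)
  refine ⟨W, hW, hfr, hW.card_le_two_mul hint hfr, by rw [hWhull, hSA], ?_⟩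
  rwa [hWhull]

theorem Convex.perimeter_closure {ω : Set Plane} (hω : Convex ℝ ω) (hint : (interior ω).Nonempty) :
    perimeter (closure ω) = perimeter ω := by
  rw [perimeter, frontier, closure_closure, hω.interior_closure_eq_interior_of_nonempty_interior hint]
  rfl

open Filter Topology in
/-- To bound the perimeter of convex sets of area `a` in a polygon, it suffices to consider
polygons. -/
theorem Convex.perimeter_le_of_forall_polygon {V : Finset Plane} {a M : ENNReal} (ha : a ≠ 0)
    (haV : a ≤ volume (convexHull ℝ (V : Set Plane)))
    (hM : ∀ S : Finset Plane, (S : Set Plane) ⊆ convexHull ℝ (V : Set Plane) →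
      volume (convexHull ℝ (S : Set Plane)) = a → perimeter (convexHull ℝ (S : Set Plane)) ≤ M)
    {ω : Set Plane} (hω : Convex ℝ ω) (hωV : ω ⊆ convexHull ℝ (V : Set Plane)) (hωa : volume ω = a) :
    perimeter ω ≤ M := by
  have hint : (interior ω).Nonempty := hω.interior_nonempty_of_volume_ne_zero (by rwa [hωa])
  obtain ⟨c, hc⟩ := hint
  rw [← hω.perimeter_closure ⟨c, hc⟩]
  set K := closure ω
  have hK : Convex ℝ K := hω.closure
  have hKc : IsCompact K := (V.finite_toSet.isCompact_convexHull ℝ).closure_of_subset hωV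
  have hKint : interior K = interior ω := hω.interior_closure_eq_interior_of_nonempty_interior ⟨c, hc⟩
  have hstep : ∀ r : ℝ, 0 < r → r < 1 → ENNReal.ofReal r * perimeter K ≤ M := by
    intro r hr hr1
    have hsub : AffineMap.homothety c r '' K ⊆ interior ω := by
      rintro _ ⟨x, hx, rfl⟩
      rw [AffineMap.homothety_eq_lineMap, AffineMap.lineMap_apply_module]
      exact hω.combo_interior_closure_mem_interior hc hx (by linarith) hr.le (by ring)
    -- A polygon between the shrunken body and `ω` has area at most `a`; enlarging it within the
    -- container to area exactly `a` gives a competitor covered by `hM`.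
    obtain ⟨S, hS, hSω⟩ := Convex.exists_subset_interior_convexHull_finset_of_isCompact
      (hK.affine_image (AffineMap.homothety c r)) (hKc.image (AffineMap.homothety_continuous c r))
      (isOpen_interior.mem_nhdsSet.2 hsub)
    have hSint : (interior (convexHull ℝ (S : Set Plane))).Nonempty :=
      ⟨c, hS ⟨c, interior_subset (hKint.symm ▸ hc), AffineMap.homothety_apply_same c r⟩⟩
    obtain ⟨S', hS'V, hS'a, hSS'⟩ := exists_superset_volume_eq (V := V)
      (((subset_convexHull ℝ _).trans hSω).trans (interior_subset.trans hωV)) hSint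
      ((measure_mono (hSω.trans interior_subset)).trans hωa.le) haV
    rw [← perimeter_homothety c hr]
    refine (perimeter_mono (hK.affine_image _) (hKc.image
      (AffineMap.homothety_continuous c r)).isClosed ⟨c, ?_⟩
      (S'.finite_toSet.isCompact_convexHull ℝ).isBounded
      ((hS.trans interior_subset).trans hSS')).trans (hM S' hS'V hS'a)
    exact (AffineMap.homothety_isOpenMap c r hr.ne').image_interior_subset K
      ⟨c, hKint.symm ▸ hc, AffineMap.homothety_apply_same c r⟩
  have hfin : perimeter K ≠ ⊤ := (perimeter_lt_top hK hKc ⟨c, hKint.symm ▸ hc⟩).ne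
  have hlim : Tendsto (fun r : ℝ => ENNReal.ofReal r * perimeter K) (𝓝[<] 1) (𝓝 (perimeter K)) := by
    have h1 := ((ENNReal.continuous_mul_const hfin).comp ENNReal.continuous_ofReal).tendsto 1
    simp only [Function.comp_apply, ENNReal.ofReal_one, one_mul] at h1
    exact h1.mono_left nhdsWithin_le_nhds
  refine le_of_tendsto hlim ?_
  filter_upwards [Ioo_mem_nhdsLT (zero_lt_one' ℝ)] with r hr
  exact hstep r hr.1 hr.2

theorem mainTheorem3 (n : ℕ) (V : Finset Plane) (hV : V.card = n) (Ω : Set Plane)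
    (hΩ : IsConvexPolygon V Ω) (A : ℝ) (hA : 0 < A) (hAΩ : ENNReal.ofReal A < volume Ω) :
    ∃ (W : Finset Plane) (P : Set Plane),
      IsConvexPolygon W P ∧ IsPerimeterMaximizer Ω A P ∧
        (∀ w ∈ W, w ∈ frontier Ω) ∧ W.card ≤ 2 * n := by
  obtain ⟨rfl, -, hint⟩ := hΩ
  subst hV
  have ha : ENNReal.ofReal A ≠ 0 := (ENNReal.ofReal_pos.2 hA).ne'
  have hcl : IsClosed (convexHull ℝ (V : Set Plane)) := V.finite_toSet.isClosed_convexHull ℝ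
  obtain ⟨W, hW, hWfr, hWcard, hWA, hWmax⟩ :=
    exists_inscribed_perimeter_max hint hA hAΩ (N := 2 * V.card) (by omega)
  refine ⟨W, convexHull ℝ (W : Set Plane), ⟨rfl, hW, ?_⟩, ⟨⟨convex_convexHull ℝ _, ?_, hWA⟩, ?_⟩,
    hWfr, hWcard⟩
  · exact (convex_convexHull ℝ _).interior_nonempty_of_volume_ne_zero (by rwa [hWA])
  · exact convexHull_min (fun w hw => hcl.frontier_subset (hWfr w hw)) (convex_convexHull ℝ _)
  · rintro ω ⟨hω, hωV, hωA⟩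
    refine hω.perimeter_le_of_forall_polygon ha hAΩ.le (fun S hS hSA => ?_) hωV hωA
    -- The optimum for as many vertices as `S` has is itself inscribed, hence has at most 2n
    -- vertices and competes with `W`.
    obtain ⟨W', -, hW'fr, hW'card, hW'A, hW'max⟩ :=
      exists_inscribed_perimeter_max hint hA hAΩ (N := max V.card S.card) (le_max_left _ _)
    exact (hW'max S hS (le_max_right _ _) hSA).trans (hWmax W'
      (fun w hw => hcl.frontier_subset (hW'fr w hw)) hW'card hW'A)
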